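/- Let $\mathbb F$ be a field. A Leibniz algebra over $\mathbb F$ is a vector space with a bilinear bracket satisfying $[x,[y,z]]=[[x,y],z]-[[x,z],y]$; a pair $(\mathfrak g,\mathfrak n)$ consists of a Leibniz algebra $\mathfrak g$ and a two-sided ideal $\mathfrak n$ of $\mathfrak g$. Let $CL_n(\mathfrak g)=\mathfrak g^{\otimes n}$ with boundary $$\partial_n(x_1\otimes\cdots\otimes x_n)=\sum_{1\le i<j\le n}(-1)^j\,x_1\otimes\cdots\otimes[x_i,x_j]\otimes\cdots\otimes\widehat{x_j}\otimes\cdots\otimes x_n ,$$ let $M_*$ be the mapping cone of the chain map $\pi_*:CL_*(\mathfrak g)\to CL_*(\mathfrak g/\mathfrak n)$ induced by the projection, i.e. $M_n=CL_{n-1}(\mathfrak g)\oplus CL_n(\mathfrak g/\mathfrak n)$ and $\delta_n(a,b)=(-\partial_{n-1}a,\ \partial_n b+\pi_{n-1}a)$, and let $HL_2(\mathfrak g,\mathfrak n)=H_3(M_*)$, regarded as an abelian Leibniz algebra. For Leibniz algebras $\mathfrak m,\mathfrak k$ acting on each other (actions written ${}^xm$, $m^x$), the non-abelian tensor product $\mathfrak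 m\ast\mathfrak k$ is the Leibniz algebra generated by the symbols $m\ast k$ and $k\ast m$ ($m\in\mathfrak m$, $k\in\mathfrak k$) subject to the following relations, for all $m,m'\in\mathfrak m$, $k,k'\in\mathfrak k$, together with those obtained from them by exchanging the roles of $\mathfrak m$ and $\mathfrak k$: $m\ast k$ is $\mathbb F$-bilinear in $(m,k)$; $m\ast[k,k']=m^k\ast k'-m^{k'}\ast k$; $[m,m']\ast k={}^mk\ast m'-m\ast k^{m'}$; $m\ast{}^{m'}k=-m\ast k^{m'}$; $m^k\ast{}^{m'}k'=[m\ast k,m'\ast k']={}^mk\ast m'^{k'}$; $m^k\ast k'^{m'}=[m\ast k,k'\ast m']={}^mk\ast{}^{k'}m'$. Let $(\mathfrak g_1,\mathfrak n_1)$ and $(\mathfrak g_2,\mathfrak n_2)$ be arbitrary pairs of Leibniz algebras over $\mathbb F$. For $i=1,2$ put $\overline{\mathfrak n_i}=\mathfrak n_i/[\mathfrak g_i,\mathfrak n_i]$, where $[\mathfrak g_i,\mathfrak n_i]$ is the span of all $[x,a]$ and $[a,x]$ with $x\in\mathfrak g_i$, $a\in\mathfrak n_i$, and $\overline{\mathfrak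 g_i}=\mathfrak g_i/[\mathfrak g_i,\mathfrak g_i]$; a bar also denotes residue classes. Form $\overline{\mathfrak n_1}\ast\overline{\mathfrak g_2}$ and $\overline{\mathfrak g_1}\ast\overline{\mathfrak n_2}$ with respect to the trivial actions, and let $\mathfrak a$ be the subalgebra of $(\overline{\mathfrak n_1}\ast\overline{\mathfrak g_2})\oplus(\overline{\mathfrak g_1}\ast\overline{\mathfrak n_2})$ generated by the elements $(\bar n_1\ast\bar n_2,\,-\bar n_1\ast\bar n_2)$ and $(\bar n_2\ast\bar n_1,\,-\bar n_2\ast\bar n_1)$ with $n_1\in\mathfrak n_1$, $n_2\in\mathfrak n_2$ (in the first component $\bar n_1\in\overline{\mathfrak n_1}$ and $\bar n_2\in\overline{\mathfrak g_2}$; in the second $\bar n_1\in\overline{\mathfrak g_1}$ and $\bar n_2\in\overline{\mathfrak n_2}$). It is an ideal, as this Leibniz algebra is abelian. Then there is an isomorphism of Leibniz algebras $$HL_2(\mathfrak g_1\oplus\mathfrak g_2,\mathfrak n_1\oplus\mathfrak n_2)\;\cong\;HL_2(\mathfrak g_1,\mathfrak n_1)\oplus HL_2(\mathfrak g_2,\mathfrak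 n_2)\oplus\frac{(\overline{\mathfrak n_1}\ast\overline{\mathfrak g_2})\oplus(\overline{\mathfrak g_1}\ast\overline{\mathfrak n_2})}{\mathfrak a}.$$ -/

import Mathlib

noncomputable section

open scoped TensorProduct

namespace RelLeibniz

/-! ### Leibniz algebras, ideals, quotients -/

/-- A (right) Leibniz algebra over a field: a bilinear bracket `br x y = [x, y]` such that
`[x, [y, z]] = [[x, y], z] - [[x, z], y]`. -/
class LeibnizAlgebra (F : Type*) (g : Type*) [Field F] [AddCommGroup g] [Module F g] where
  br : g →ₗ[F] g →ₗ[F] g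
  leibniz : ∀ x y z : g, br x (br y z) = br (br x y) z - br (br x z) y

/-- The bracket of a Leibniz algebra over `F`. -/
abbrev br (F : Type*) {g : Type*} [Field F] [AddCommGroup g] [Module F g] [LeibnizAlgebra F g] :
    g →ₗ[F] g →ₗ[F] g :=
  LeibnizAlgebra.br

section Basic

variable (F : Type*) [Field F]

/-- An isomorphism of Leibniz algebras. -/
structure LeibnizEquiv (g h : Type*) [AddCommGroup g] [Module F g] [LeibnizAlgebra F g]
    [AddCommGroup h] [Module F h] [LeibnizAlgebra F h] extends g ≃ₗ[F] h where
  map_br : ∀ x y : g, toFun (br F x y) = br F (toFun x) (toFun y)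

variable (g : Type*) [AddCommGroup g] [Module F g] [LeibnizAlgebra F g]

/-- A two-sided ideal of a Leibniz algebra; `(g, n)` with `n` an ideal of `g` is a pair of
Leibniz algebras. -/
structure LeibnizIdeal extends Submodule F g where
  br_mem_left : ∀ (x : g) {n : g}, n ∈ toSubmodule → br F x n ∈ toSubmodule
  br_mem_right : ∀ {n : g} (x : g), n ∈ toSubmodule → br F n x ∈ toSubmodule

end Basic

section Constructions

variable {F : Type*} [Field F]

/-- The direct sum of two Leibniz algebras, with componentwise bracket. -/
instance instProd {g h : Type*} [AddCommGroup g] [Module F g] [LeibnizAlgebra F g]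
    [AddCommGroup h] [Module F h] [LeibnizAlgebra F h] : LeibnizAlgebra F (g × h) where
  br := LinearMap.mk₂ F (fun x y => (br F x.1 y.1, br F x.2 y.2))
    (by intros; simp) (by intros; simp) (by intros; simp) (by intros; simp)
  leibniz x y z := by
    ext
    · simpa using LeibnizAlgebra.leibniz (F := F) x.1 y.1 z.1
    · simpa using LeibnizAlgebra.leibniz (F := F) x.2 y.2 z.2

/-- A bilinear product on `A` descends to the quotient by a subspace that is stable under left
and right multiplication. -/
def quotBr {A : Type*} [AddCommGroup A] [Module F A] (β : A →ₗ[F] A →ₗ[F] A) (I : Submodule F A)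
    (hl : ∀ a, ∀ x ∈ I, β a x ∈ I) (hr : ∀ a, ∀ x ∈ I, β x a ∈ I) :
    (A ⧸ I) →ₗ[F] (A ⧸ I) →ₗ[F] (A ⧸ I) :=
  I.liftQ
    { toFun := fun a => I.mapQ I (β a) (fun x hx => hl a x hx)
      map_add' := by intro a b; ext x; simp
      map_smul' := by intro c a; ext x; simp }
    (by
      intro x hx
      rw [LinearMap.mem_ker]
      ext a
      simpa using hr a x hx)

@[simp] theorem quotBr_mk {A : Type*} [AddCommGroup A] [Module F A] (β : A →ₗ[F] A →ₗ[F] A)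
    (I : Submodule F A) (hl : ∀ a, ∀ x ∈ I, β a x ∈ I) (hr : ∀ a, ∀ x ∈ I, β x a ∈ I) (a b : A) :
    quotBr β I hl hr (Submodule.Quotient.mk a) (Submodule.Quotient.mk b) =
      Submodule.Quotient.mk (β a b) :=
  rfl

variable {g : Type*} [AddCommGroup g] [Module F g] [LeibnizAlgebra F g]

/-- The quotient Leibniz algebra `g / n`. -/
instance instQuotient (n : LeibnizIdeal F g) : LeibnizAlgebra F (g ⧸ n.toSubmodule) where
  br := quotBr (br F) n.toSubmodule (fun a _ hx => n.br_mem_left a hx)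
    (fun a _ hx => n.br_mem_right a hx)
  leibniz x y z := by
    induction x using Submodule.Quotient.induction_on
    induction y using Submodule.Quotient.induction_on
    induction z using Submodule.Quotient.induction_on
    simp only [quotBr_mk, ← Submodule.Quotient.mk_sub]
    rw [br, LeibnizAlgebra.leibniz]

/-- An ideal is a Leibniz algebra with the restricted bracket. -/
instance instIdeal (n : LeibnizIdeal F g) : LeibnizAlgebra F n.toSubmodule where
  br := LinearMap.mk₂ F (fun x y => ⟨br F (x : g) (y : g), n.br_mem_left _ y.2⟩)
    (by intros; ext; simp) (by intros; ext; simp) (by intros; ext; simp) (by intros; ext; simp)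
  leibniz x y z := by
    ext
    simpa using LeibnizAlgebra.leibniz (F := F) (x : g) (y : g) (z : g)

namespace LeibnizIdeal

/-- The whole algebra as an ideal. -/
def whole (F : Type*) [Field F] (g : Type*) [AddCommGroup g] [Module F g] [LeibnizAlgebra F g] :
    LeibnizIdeal F g where
  toSubmodule := ⊤
  br_mem_left _ _ _ := Submodule.mem_top
  br_mem_right _ _ := Submodule.mem_top

/-- The ideal `n₁ ⊕ n₂` of `g₁ ⊕ g₂`. -/
def prod {h : Type*} [AddCommGroup h] [Module F h] [LeibnizAlgebra F h]
    (n₁ : LeibnizIdeal F g) (n₂ : LeibnizIdeal F h) : LeibnizIdeal F (g × h) where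
  toSubmodule := n₁.toSubmodule.prod n₂.toSubmodule
  br_mem_left x _ hn := ⟨n₁.br_mem_left x.1 hn.1, n₂.br_mem_left x.2 hn.2⟩
  br_mem_right x hn := ⟨n₁.br_mem_right x.1 hn.1, n₂.br_mem_right x.2 hn.2⟩

/-- The subspace `[g, n]` spanned by all `[x, a]` and `[a, x]` with `x ∈ g`, `a ∈ n`. -/
def commSpan (n : LeibnizIdeal F g) : Submodule F g :=
  Submodule.span F {y | ∃ x : g, ∃ a ∈ n.toSubmodule, y = br F x a ∨ y = br F a x}

theorem commSpan_le (n : LeibnizIdeal F g) : n.commSpan ≤ n.toSubmodule := by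
  refine Submodule.span_le.2 ?_
  rintro y ⟨x, a, ha, rfl | rfl⟩
  · exact n.br_mem_left x ha
  · exact n.br_mem_right x ha

/-- The commutator `[g, n]` as an ideal of `g`. -/
def comm (n : LeibnizIdeal F g) : LeibnizIdeal F g where
  toSubmodule := n.commSpan
  br_mem_left x _ ha := Submodule.subset_span ⟨x, _, n.commSpan_le ha, Or.inl rfl⟩
  br_mem_right x ha := Submodule.subset_span ⟨x, _, n.commSpan_le ha, Or.inr rfl⟩

/-- The commutator `[g, n]` as an ideal of `n`. -/
def commIn (n : LeibnizIdeal F g) : LeibnizIdeal F n.toSubmodule where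
  toSubmodule := n.comm.toSubmodule.comap n.toSubmodule.subtype
  br_mem_left x _ ha := n.comm.br_mem_left (x : g) ha
  br_mem_right x ha := n.comm.br_mem_right (x : g) ha

/-- `n̄ = n / [g, n]`. -/
abbrev Bar (n : LeibnizIdeal F g) : Type _ := n.toSubmodule ⧸ n.commIn.toSubmodule

/-- The class in `n̄ = n / [g, n]` of an element of `n`. -/
def toBar (n : LeibnizIdeal F g) : n.toSubmodule →ₗ[F] n.Bar := n.commIn.toSubmodule.mkQ

end LeibnizIdeal

/-- The abelianization `ḡ = g / [g, g]`. -/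
abbrev Ab (F : Type*) [Field F] (g : Type*) [AddCommGroup g] [Module F g] [LeibnizAlgebra F g] :
    Type _ :=
  g ⧸ (LeibnizIdeal.whole F g).comm.toSubmodule

/-- The class of an element of `g` in `ḡ = g / [g, g]`. -/
def toAb (F : Type*) [Field F] {g : Type*} [AddCommGroup g] [Module F g] [LeibnizAlgebra F g] :
    g →ₗ[F] Ab F g :=
  (LeibnizIdeal.whole F g).comm.toSubmodule.mkQ

/-- The (underlying space of the) Leibniz subalgebra generated by a set: the smallest subspace
which contains the set and is closed under the bracket. -/
def subalgebraClosure (s : Set g) : Submodule F g :=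
  sInf {S : Submodule F g | s ⊆ S ∧ ∀ x ∈ S, ∀ y ∈ S, br F x y ∈ S}

end Constructions

/-! ### Leibniz algebras given by generators and relations -/

section Presented

variable {F : Type*} [Field F] {X : Type*}

/-- The two-sided ideal of the free non-associative algebra on `X` generated by the relations
`a = b` (for `r a b`) and by the Leibniz identity. -/
def relIdeal (r : FreeNonUnitalNonAssocAlgebra F X → FreeNonUnitalNonAssocAlgebra F X → Prop) :
    Submodule F (FreeNonUnitalNonAssocAlgebra F X) :=
  sInf {I | (∀ a b, r a b → a - b ∈ I) ∧
    (∀ a b c, a * (b * c) - ((a * b) * c - (a * c) * b) ∈ I) ∧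
    ∀ a, ∀ x ∈ I, a * x ∈ I ∧ x * a ∈ I}

variable (r : FreeNonUnitalNonAssocAlgebra F X → FreeNonUnitalNonAssocAlgebra F X → Prop)

theorem sub_mem_relIdeal {a b : FreeNonUnitalNonAssocAlgebra F X} (h : r a b) :
    a - b ∈ relIdeal r :=
  Submodule.mem_sInf.2 fun _ hI => hI.1 a b h

theorem leibniz_mem_relIdeal (a b c : FreeNonUnitalNonAssocAlgebra F X) :
    a * (b * c) - ((a * b) * c - (a * c) * b) ∈ relIdeal r :=
  Submodule.mem_sInf.2 fun _ hI => hI.2.1 a b c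

theorem mul_mem_relIdeal (a : FreeNonUnitalNonAssocAlgebra F X) :
    ∀ x ∈ relIdeal r, a * x ∈ relIdeal r := fun x hx =>
  Submodule.mem_sInf.2 fun I hI => (hI.2.2 a x (Submodule.mem_sInf.1 hx I hI)).1

theorem mem_mul_relIdeal (a : FreeNonUnitalNonAssocAlgebra F X) :
    ∀ x ∈ relIdeal r, x * a ∈ relIdeal r := fun x hx =>
  Submodule.mem_sInf.2 fun I hI => (hI.2.2 a x (Submodule.mem_sInf.1 hx I hI)).2

/-- The Leibniz algebra generated by the symbols in `X` subject to the relations `r`. -/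
def Presented : Type _ := FreeNonUnitalNonAssocAlgebra F X ⧸ relIdeal r

instance : AddCommGroup (Presented r) :=
  inferInstanceAs (AddCommGroup (FreeNonUnitalNonAssocAlgebra F X ⧸ relIdeal r))

instance : Module F (Presented r) :=
  inferInstanceAs (Module F (FreeNonUnitalNonAssocAlgebra F X ⧸ relIdeal r))

/-- The class of an element of the free algebra. -/
def Presented.mk : FreeNonUnitalNonAssocAlgebra F X →ₗ[F] Presented r := (relIdeal r).mkQ

/-- The image of a generator. -/
def Presented.gen (x : X) : Presented r :=
  Presented.mk r (FreeNonUnitalNonAssocAlgebra.of F x)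

theorem Presented.mk_surjective : Function.Surjective (Presented.mk r) :=
  (relIdeal r).mkQ_surjective

instance : LeibnizAlgebra F (Presented r) where
  br := quotBr (LinearMap.mul F (FreeNonUnitalNonAssocAlgebra F X)) (relIdeal r)
    (mul_mem_relIdeal r) (mem_mul_relIdeal r)
  leibniz x y z := by
    obtain ⟨a, rfl⟩ := Presented.mk_surjective r x
    obtain ⟨b, rfl⟩ := Presented.mk_surjective r y
    obtain ⟨c, rfl⟩ := Presented.mk_surjective r z
    exact (Submodule.Quotient.eq _).2 (leibniz_mem_relIdeal r a b c)

theorem Presented.br_mk (a b : FreeNonUnitalNonAssocAlgebra F X) :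
    br F (Presented.mk r a) (Presented.mk r b) = Presented.mk r (a * b) :=
  rfl

theorem Presented.mk_eq {a b : FreeNonUnitalNonAssocAlgebra F X} (h : r a b) :
    Presented.mk r a = Presented.mk r b :=
  (Submodule.Quotient.eq _).2 (sub_mem_relIdeal r h)

/-- If all brackets of generators vanish, then the algebra is abelian. -/
theorem Presented.br_eq_zero (h : ∀ x y : X, br F (Presented.gen r x) (Presented.gen r y) = 0)
    (u v : Presented r) : br F u v = 0 := by
  have single_mul (a b : FreeMagma X) :
      (MonoidAlgebra.single (a * b) 1 : FreeNonUnitalNonAssocAlgebra F X) =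
        MonoidAlgebra.single a 1 * MonoidAlgebra.single b 1 := by
    rw [MonoidAlgebra.single_mul_single, one_mul]
  have key : ∀ a : FreeMagma X,
      (∃ x, a = FreeMagma.of x) ∨
        Presented.mk r (MonoidAlgebra.single a 1) = 0 := by
    intro a
    induction a using FreeMagma.recOnMul with
    | ih1 x => exact Or.inl ⟨x, rfl⟩
    | ih2 a b ha hb =>
      right
      rw [single_mul, ← Presented.br_mk]
      rcases ha with ⟨x, rfl⟩ | ha
      · rcases hb with ⟨y, rfl⟩ | hb
        · exact h x y
        · rw [hb, map_zero]
      · rw [ha, map_zero, LinearMap.zero_apply]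
  have main : ∀ a b : FreeMagma X, br F (Presented.mk r (MonoidAlgebra.single a 1))
      (Presented.mk r (MonoidAlgebra.single b 1)) = 0 := by
    intro a b
    rcases key a with ⟨x, rfl⟩ | ha
    · rcases key b with ⟨y, rfl⟩ | hb
      · exact h x y
      · rw [hb, map_zero]
    · rw [ha, map_zero, LinearMap.zero_apply]
  obtain ⟨a, rfl⟩ := Presented.mk_surjective r u
  obtain ⟨b, rfl⟩ := Presented.mk_surjective r v
  have hz : (br F).compl₁₂ (Presented.mk r) (Presented.mk r) = 0 := by
    refine MonoidAlgebra.lhom_ext' fun a => LinearMap.ext_ring ?_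
    refine MonoidAlgebra.lhom_ext' fun b => LinearMap.ext_ring ?_
    exact main a b
  exact LinearMap.congr_fun₂ hz a b

end Presented

/-! ### Actions and the non-abelian tensor product -/

/-- An action of the Leibniz algebra `g` on the Leibniz algebra `m`: bilinear maps
`left x a = ˣa` and `right a x = aˣ`. -/
structure LeibnizAction (F : Type*) [Field F] (g m : Type*)
    [AddCommGroup g] [Module F g] [LeibnizAlgebra F g]
    [AddCommGroup m] [Module F m] [LeibnizAlgebra F m] where
  left : g →ₗ[F] m →ₗ[F] m
  right : m →ₗ[F] g →ₗ[F] m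
  left_br : ∀ (x x' : g) (a : m), left (br F x x') a = left x (left x' a) + right (left x a) x'
  right_br : ∀ (x x' : g) (a : m),
    right a (br F x x') = right (right a x) x' - right (right a x') x
  left_left : ∀ (x x' : g) (a : m), left x (left x' a) = -left x (right a x')
  left_of_br : ∀ (x : g) (a a' : m), left x (br F a a') = br F (left x a) a' - br F (left x a') a
  right_of_br : ∀ (x : g) (a a' : m),
    right (br F a a') x = br F (right a x) a' + br F a (right a' x)
  br_left : ∀ (x : g) (a a' : m), br F a (left x a') = -br F a (right a' x)

/-- The trivial action. -/
def LeibnizAction.trivial (F : Type*) [Field F] (g m : Type*)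
    [AddCommGroup g] [Module F g] [LeibnizAlgebra F g]
    [AddCommGroup m] [Module F m] [LeibnizAlgebra F m] : LeibnizAction F g m where
  left := 0
  right := 0
  left_br := by simp
  right_br := by simp
  left_left := by simp
  left_of_br := by simp
  right_of_br := by simp
  br_left := by simp

section Tensor

variable {F : Type*} [Field F] {m n : Type*}
  [AddCommGroup m] [Module F m] [LeibnizAlgebra F m]
  [AddCommGroup n] [Module F n] [LeibnizAlgebra F n]

/-- The symbol `a ∗ b` with `a ∈ m`, `b ∈ n`. -/
def symL (F : Type*) [Field F] {m n : Type*} (a : m) (b : n) :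
    FreeNonUnitalNonAssocAlgebra F ((m × n) ⊕ (n × m)) :=
  FreeNonUnitalNonAssocAlgebra.of F (Sum.inl (a, b))

/-- The symbol `b ∗ a` with `b ∈ n`, `a ∈ m`. -/
def symR (F : Type*) [Field F] {m n : Type*} (b : n) (a : m) :
    FreeNonUnitalNonAssocAlgebra F ((m × n) ⊕ (n × m)) :=
  FreeNonUnitalNonAssocAlgebra.of F (Sum.inr (b, a))

/-- The defining relations of the non-abelian tensor product `m ∗ n` of two Leibniz algebras that
act on each other; `A` is the action of `m` on `n` and `B` the action of `n` on `m`. -/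
inductive TensorRel (A : LeibnizAction F m n) (B : LeibnizAction F n m) :
    FreeNonUnitalNonAssocAlgebra F ((m × n) ⊕ (n × m)) →
    FreeNonUnitalNonAssocAlgebra F ((m × n) ⊕ (n × m)) → Prop
  | smulL₁ (c : F) (a : m) (b : n) : TensorRel A B (c • symL F a b) (symL F (c • a) b)
  | smulL₂ (c : F) (a : m) (b : n) : TensorRel A B (c • symL F a b) (symL F a (c • b))
  | smulR₁ (c : F) (b : n) (a : m) : TensorRel A B (c • symR F b a) (symR F (c • b) a)
  | smulR₂ (c : F) (b : n) (a : m) : TensorRel A B (c • symR F b a) (symR F b (c • a))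
  | addL₁ (a a' : m) (b : n) : TensorRel A B (symL F (a + a') b) (symL F a b + symL F a' b)
  | addR₁ (b b' : n) (a : m) : TensorRel A B (symR F (b + b') a) (symR F b a + symR F b' a)
  | addL₂ (a : m) (b b' : n) : TensorRel A B (symL F a (b + b')) (symL F a b + symL F a b')
  | addR₂ (b : n) (a a' : m) : TensorRel A B (symR F b (a + a')) (symR F b a + symR F b a')
  | brL₂ (a : m) (b b' : n) :
      TensorRel A B (symL F a (br F b b')) (symL F (B.right a b) b' - symL F (B.right a b') b)
  | brR₂ (b : n) (a a' : m) :
      TensorRel A B (symR F b (br F a a')) (symR F (A.right b a) a' - symR F (A.right b a') a)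
  | brL₁ (a a' : m) (b : n) :
      TensorRel A B (symL F (br F a a') b) (symR F (A.left a b) a' - symL F a (A.right b a'))
  | brR₁ (b b' : n) (a : m) :
      TensorRel A B (symR F (br F b b') a) (symL F (B.left b a) b' - symR F b (B.right a b'))
  | actL (a a' : m) (b : n) : TensorRel A B (symL F a (A.left a' b)) (-symL F a (A.right b a'))
  | actR (b b' : n) (a : m) : TensorRel A B (symR F b (B.left b' a)) (-symR F b (B.right a b'))
  | mulLL₁ (a a' : m) (b b' : n) :
      TensorRel A B (symL F a b * symL F a' b') (symL F (B.right a b) (A.left a' b'))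
  | mulLL₂ (a a' : m) (b b' : n) :
      TensorRel A B (symL F a b * symL F a' b') (symR F (A.left a b) (B.right a' b'))
  | mulRR₁ (a a' : m) (b b' : n) :
      TensorRel A B (symR F b a * symR F b' a') (symL F (B.left b a) (A.right b' a'))
  | mulRR₂ (a a' : m) (b b' : n) :
      TensorRel A B (symR F b a * symR F b' a') (symR F (A.right b a) (B.left b' a'))
  | mulLR₁ (a a' : m) (b b' : n) :
      TensorRel A B (symL F a b * symR F b' a') (symL F (B.right a b) (A.right b' a'))
  | mulLR₂ (a a' : m) (b b' : n) :
      TensorRel A B (symL F a b * symR F b' a') (symR F (A.left a b) (B.left b' a'))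
  | mulRL₁ (a a' : m) (b b' : n) :
      TensorRel A B (symR F b a * symL F a' b') (symL F (B.left b a) (A.left a' b'))
  | mulRL₂ (a a' : m) (b b' : n) :
      TensorRel A B (symR F b a * symL F a' b') (symR F (A.right b a) (B.right a' b'))

/-- The non-abelian tensor product `m ∗ n` of two Leibniz algebras acting on each other: the
Leibniz algebra generated by the symbols `a ∗ b` and `b ∗ a` subject to the relations above. -/
abbrev NonabTensor (A : LeibnizAction F m n) (B : LeibnizAction F n m) : Type _ :=
  Presented (TensorRel A B)

/-- The non-abelian tensor product `m ∗ n` of two Leibniz algebras that act trivially on each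
other. -/
abbrev TrivTensor (F : Type*) [Field F] (m n : Type*)
    [AddCommGroup m] [Module F m] [LeibnizAlgebra F m]
    [AddCommGroup n] [Module F n] [LeibnizAlgebra F n] : Type _ :=
  NonabTensor (LeibnizAction.trivial F m n) (LeibnizAction.trivial F n m)

/-- The generator `a ∗ b` (`a ∈ m`, `b ∈ n`) of `m ∗ n` for trivial actions. -/
def tmulL (F : Type*) [Field F] {m n : Type*}
    [AddCommGroup m] [Module F m] [LeibnizAlgebra F m]
    [AddCommGroup n] [Module F n] [LeibnizAlgebra F n] (a : m) (b : n) : TrivTensor F m n :=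
  Presented.gen _ (Sum.inl (a, b))

/-- The generator `b ∗ a` (`b ∈ n`, `a ∈ m`) of `m ∗ n` for trivial actions. -/
def tmulR (F : Type*) [Field F] {m n : Type*}
    [AddCommGroup m] [Module F m] [LeibnizAlgebra F m]
    [AddCommGroup n] [Module F n] [LeibnizAlgebra F n] (b : n) (a : m) : TrivTensor F m n :=
  Presented.gen _ (Sum.inr (b, a))

theorem tmulL_zero (a : m) : tmulL F a (0 : n) = 0 := by
  have h := Presented.mk_eq _ (TensorRel.smulL₂ (A := LeibnizAction.trivial F m n)
    (B := LeibnizAction.trivial F n m) 0 a 0)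
  rw [zero_smul, map_zero, zero_smul] at h
  exact h.symm

/-- For trivial actions the tensor product is an abelian Leibniz algebra. -/
theorem TrivTensor.br_eq_zero (u v : TrivTensor F m n) : br F u v = 0 := by
  have h0 := tmulL_zero (F := F) (n := n) (0 : m)
  refine Presented.br_eq_zero _ ?_ u v
  rintro (⟨a, b⟩ | ⟨b, a⟩) (⟨a', b'⟩ | ⟨b', a'⟩)
  · exact (Presented.mk_eq _ (TensorRel.mulLL₁ a a' b b')).trans h0
  · exact (Presented.mk_eq _ (TensorRel.mulLR₁ a a' b b')).trans h0
  · exact (Presented.mk_eq _ (TensorRel.mulRL₁ a a' b b')).trans h0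
  · exact (Presented.mk_eq _ (TensorRel.mulRR₁ a a' b b')).trans h0

end Tensor

/-! ### The mixed term -/

section Mixed

variable {F : Type*} [Field F] {g₁ g₂ : Type*}
  [AddCommGroup g₁] [Module F g₁] [LeibnizAlgebra F g₁]
  [AddCommGroup g₂] [Module F g₂] [LeibnizAlgebra F g₂]

/-- The Leibniz algebra `(n̄₁ ∗ ḡ₂) ⊕ (ḡ₁ ∗ n̄₂)`. As `g₁` and `g₂` act trivially on each other
inside `g₁ ⊕ g₂`, all the actions involved are trivial. -/
abbrev MixedSum (n₁ : LeibnizIdeal F g₁) (n₂ : LeibnizIdeal F g₂) : Type _ :=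
  TrivTensor F n₁.Bar (Ab F g₂) × TrivTensor F (Ab F g₁) n₂.Bar

/-- The generators `(ā₁ ∗ ā₂, -ā₁ ∗ ā₂)` and `(ā₂ ∗ ā₁, -ā₂ ∗ ā₁)`, `a₁ ∈ n₁`, `a₂ ∈ n₂`. -/
def mixedGenerators (n₁ : LeibnizIdeal F g₁) (n₂ : LeibnizIdeal F g₂) : Set (MixedSum n₁ n₂) :=
  {z | ∃ (a₁ : n₁.toSubmodule) (a₂ : n₂.toSubmodule),
    z = (tmulL F (n₁.toBar a₁) (toAb F (a₂ : g₂)), -tmulL F (toAb F (a₁ : g₁)) (n₂.toBar a₂)) ∨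
    z = (tmulR F (toAb F (a₂ : g₂)) (n₁.toBar a₁), -tmulR F (n₂.toBar a₂) (toAb F (a₁ : g₁)))}

theorem MixedSum.br_eq_zero (n₁ : LeibnizIdeal F g₁) (n₂ : LeibnizIdeal F g₂)
    (u v : MixedSum n₁ n₂) : br F u v = 0 :=
  Prod.ext (TrivTensor.br_eq_zero u.1 v.1) (TrivTensor.br_eq_zero u.2 v.2)

/-- The subalgebra `𝔞` of `(n̄₁ ∗ ḡ₂) ⊕ (ḡ₁ ∗ n̄₂)` generated by the elements above; it is an ideal
because the ambient algebra is abelian. -/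
def mixedIdeal (n₁ : LeibnizIdeal F g₁) (n₂ : LeibnizIdeal F g₂) :
    LeibnizIdeal F (MixedSum n₁ n₂) where
  toSubmodule := subalgebraClosure (mixedGenerators n₁ n₂)
  br_mem_left x n _ := by rw [MixedSum.br_eq_zero]; exact Submodule.zero_mem _
  br_mem_right x _ := by rw [MixedSum.br_eq_zero]; exact Submodule.zero_mem _

/-- The quotient `((n̄₁ ∗ ḡ₂) ⊕ (ḡ₁ ∗ n̄₂)) / 𝔞`. -/
abbrev MixedTerm (n₁ : LeibnizIdeal F g₁) (n₂ : LeibnizIdeal F g₂) : Type _ :=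
  MixedSum n₁ n₂ ⧸ (mixedIdeal n₁ n₂).toSubmodule

end Mixed

/-! ### Leibniz homology of a pair -/

section HomologyAt

variable {F : Type*} [Field F] {A B C : Type*} [AddCommGroup A] [Module F A]
  [AddCommGroup B] [Module F B] [AddCommGroup C] [Module F C]

/-- The homology `ker d / im d'` at the middle term of `A → B → C`. -/
def HomologyAt (d' : A →ₗ[F] B) (d : B →ₗ[F] C) : Type _ :=
  LinearMap.ker d ⧸ (LinearMap.range d').comap (LinearMap.ker d).subtype

variable (d' : A →ₗ[F] B) (d : B →ₗ[F] C)

instance : AddCommGroup (HomologyAt d' d) :=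
  inferInstanceAs
    (AddCommGroup (LinearMap.ker d ⧸ (LinearMap.range d').comap (LinearMap.ker d).subtype))

instance : Module F (HomologyAt d' d) :=
  inferInstanceAs
    (Module F (LinearMap.ker d ⧸ (LinearMap.range d').comap (LinearMap.ker d).subtype))

end HomologyAt

section Homology

variable (F : Type*) [Field F] (g : Type*) [AddCommGroup g] [Module F g] [LeibnizAlgebra F g]

/-- Leibniz chains with trivial coefficients, `CL_n(g) = g^{⊗ n}`. -/
abbrev CL (n : ℕ) : Type _ := ⨂[F]^n g

variable {g}

/-- The multilinear map that drops the entry `x_j` and replaces the entry in position `i` of the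
remaining list, which is `x_{j.succAbove i}`, by `[x_{j.succAbove i}, x_j]`.
For `i < j` this is `x₀ ⊗ ⋯ ⊗ [x_i, x_j] ⊗ ⋯ ⊗ x̂_j ⊗ ⋯ ⊗ x_n`. -/
def face {n : ℕ} (j : Fin (n + 1)) (i : Fin n) :
    MultilinearMap F (fun _ : Fin (n + 1) => g) (CL F g n) :=
  MultilinearMap.mk'
    (fun x => PiTensorProduct.tprod F
      (Function.update (j.removeNth x : Fin n → g) i (br F (x (j.succAbove i)) (x j))))
    (by
      intro x l u v
      rcases Fin.eq_self_or_eq_succAbove j l with rfl | ⟨k, rfl⟩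
      · simp
      · by_cases hk : k = i
        · subst hk
          simp
        · have hki : j.succAbove i ≠ j.succAbove k :=
            fun h => hk (Fin.succAbove_right_injective h).symm
          simp [Function.update_of_ne hki, Function.update_comm hk])
    (by
      intro x l c u
      rcases Fin.eq_self_or_eq_succAbove j l with rfl | ⟨k, rfl⟩
      · simp
      · by_cases hk : k = i
        · subst hk
          simp
        · have hki : j.succAbove i ≠ j.succAbove k :=
            fun h => hk (Fin.succAbove_right_injective h).symm
          simp [Function.update_of_ne hki, Function.update_comm hk])

variable (g)

/-- The boundary map `∂_{n+1} : CL_{n+1}(g) → CL_n(g)`,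
`∂(x₁ ⊗ ⋯ ⊗ x_{n+1}) = ∑_{i < j} (-1)^j x₁ ⊗ ⋯ ⊗ [x_i, x_j] ⊗ ⋯ ⊗ x̂_j ⊗ ⋯ ⊗ x_{n+1}`.
Indices in the code start at `0`, hence the exponent `j + 1`. -/
def boundary (n : ℕ) : CL F g (n + 1) →ₗ[F] CL F g n :=
  PiTensorProduct.lift (∑ j : Fin (n + 1), ∑ i : Fin n,
    if i.castSucc < j then (-1 : F) ^ ((j : ℕ) + 1) • face F j i else 0)

variable {F g}
variable (n : LeibnizIdeal F g)

/-- The chain map `CL_k(g) → CL_k(g / n)` induced by the projection. -/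
def projChain (k : ℕ) : CL F g k →ₗ[F] CL F (g ⧸ n.toSubmodule) k :=
  PiTensorProduct.map (fun _ => n.toSubmodule.mkQ)

/-- The differential `δ_{k+2} : M_{k+2} → M_{k+1}` of the mapping cone `M` of
`CL_*(g) → CL_*(g / n)`, where `M_{k+1} = CL_k(g) ⊕ CL_{k+1}(g / n)` and
`δ(a, b) = (-∂ a, ∂ b + π a)`. -/
def coneBoundary (k : ℕ) :
    (CL F g (k + 1) × CL F (g ⧸ n.toSubmodule) (k + 2)) →ₗ[F]
      (CL F g k × CL F (g ⧸ n.toSubmodule) (k + 1)) :=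
  LinearMap.prod
    (-(boundary F g k ∘ₗ LinearMap.fst F _ _))
    (boundary F (g ⧸ n.toSubmodule) (k + 1) ∘ₗ LinearMap.snd F _ _ +
      projChain n (k + 1) ∘ₗ LinearMap.fst F _ _)

/-- The second relative homology `HL₂(g, n) = H₃(M) = ker δ₃ / im δ₄`. -/
def HL₂ : Type _ := HomologyAt (coneBoundary n 2) (coneBoundary n 1)

instance : AddCommGroup (HL₂ n) :=
  inferInstanceAs (AddCommGroup (HomologyAt (coneBoundary n 2) (coneBoundary n 1)))

instance : Module F (HL₂ n) :=
  inferInstanceAs (Module F (HomologyAt (coneBoundary n 2) (coneBoundary n 1)))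

/-- Relative homology is regarded as an abelian Leibniz algebra. -/
instance : LeibnizAlgebra F (HL₂ n) where
  br := 0
  leibniz := by simp

end Homology

end RelLeibniz

end

/-!
Write `K` for the kernel of `CL_*(g) → CL_*(g / n)`. This chain map is onto, so its mapping cone has
the homology of `K` shifted by one, and `HL₂(g, n)` becomes `(ker ∂ ∩ K₂) / ∂ K₃` (`HL₂Equiv`). Over
a field, `K_k` is spanned by the pure tensors with at least one entry in `n` (`ker_CLmap`), which
reduces all verifications to generators.

For `g = g₁ ⊕ g₂` and `n = n₁ ⊕ n₂`, the space `K₂` is the direct sum of the corresponding spaces for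
the two pairs and of a mixed part, made up of `n₁ ⊗ g₂ + g₁ ⊗ n₂` and of `n₂ ⊗ g₁ + g₂ ⊗ n₁`. The
boundary map vanishes on the mixed part, because `g₁` and `g₂` commute, and the boundaries in it are
spanned by the tensors `c ⊗ y` and `y ⊗ c` where `c` lies in `[gᵢ, nᵢ]`, or where `c` lies in
`[gᵢ, gᵢ]` and `y` in `n`. So the mixed part contributes the pushout of `n̄₁ ⊗ ḡ₂` and `ḡ₁ ⊗ n̄₂` over
the image of `n₁ ⊗ n₂`, once for each order of the factors. This is the mixed term, as `m ∗ k` for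
trivial actions on abelian algebras is `(m ⊗ k) ⊕ (k ⊗ m)` (`TrivTensor.lift`).

The identification of the mixed part is carried out by two maps. `mixedPart` goes from
`CL₂(g₁ ⊕ g₂)` to the mixed term and kills the relative boundaries; linear retractions of `gᵢ` onto
`nᵢ` are used to define it on all chains. `mixedLift` goes back to chains modulo relative boundaries,
and on relative chains the composite discards the unmixed components (`mixedLift_mixedPart`). Hence
`decompose`, which collects the two components and the mixed part of a relative cycle, is onto and
has the relative boundaries as its kernel (`decompose_surjective`, `ker_decompose`). Relative homology
and the mixed term have zero bracket, so a linear isomorphism is enough.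
-/

noncomputable section

open scoped TensorProduct

namespace RelLeibniz

/-! ### Tensor powers of a vector space -/

section Chains

theorem update_pair_zero {α : Type*} (x y a : α) : Function.update ![x, y] 0 a = ![a, y] := by
  ext i; fin_cases i <;> rfl

theorem update_pair_one {α : Type*} (x y a : α) : Function.update ![x, y] 1 a = ![x, a] := by
  ext i; fin_cases i <;> rfl

theorem update_singleton {α : Type*} (x a : α) : Function.update ![x] 0 a = ![a] := by
  ext i; fin_cases i; rfl

variable {F : Type*} [Field F] {g h : Type*} [AddCommGroup g] [Module F g] [AddCommGroup h]
  [Module F h]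

/-- The tensor `x ⊗ y ∈ CL₂(g)` as a bilinear map. -/
def pure₂ (F : Type*) [Field F] {g : Type*} [AddCommGroup g] [Module F g] :
    g →ₗ[F] g →ₗ[F] CL F g 2 :=
  LinearMap.mk₂ F (fun x y => PiTensorProduct.tprod F ![x, y])
    (fun x x' y => by
      simpa only [update_pair_zero] using
        (PiTensorProduct.tprod F).map_update_add ![x, y] 0 x x')
    (fun c x y => by
      simpa only [update_pair_zero] using
        (PiTensorProduct.tprod F).map_update_smul ![x, y] 0 c x)
    (fun x y y' => by
      simpa only [update_pair_one] using
        (PiTensorProduct.tprod F).map_update_add ![x, y] 1 y y')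
    (fun c x y => by
      simpa only [update_pair_one] using
        (PiTensorProduct.tprod F).map_update_smul ![x, y] 1 c y)

theorem pure₂_apply (x y : g) : pure₂ F x y = PiTensorProduct.tprod F ![x, y] := rfl

/-- The degree one chain `x ∈ CL₁(g)`, as a linear map. -/
def pure₁ (F : Type*) [Field F] {g : Type*} [AddCommGroup g] [Module F g] : g →ₗ[F] CL F g 1 where
  toFun x := PiTensorProduct.tprod F ![x]
  map_add' x y := by
    simpa only [update_singleton] using (PiTensorProduct.tprod F).map_update_add ![x] 0 x y
  map_smul' c x := by
    simpa only [update_singleton, RingHom.id_apply] using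
      (PiTensorProduct.tprod F).map_update_smul ![x] 0 c x

theorem pure₁_apply (x : g) : pure₁ F x = PiTensorProduct.tprod F ![x] := rfl

/-- The linear map on `CL₂(g)` determined by a bilinear map. -/
def liftCL₂ {V : Type*} [AddCommGroup V] [Module F V] (f : g →ₗ[F] g →ₗ[F] V) :
    CL F g 2 →ₗ[F] V :=
  PiTensorProduct.lift (MultilinearMap.mk' (fun v => f (v 0) (v 1))
    (by intro v i x y; fin_cases i <;> simp) (by intro v i c x; fin_cases i <;> simp))

@[simp] theorem liftCL₂_pure₂ {V : Type*} [AddCommGroup V] [Module F V] (f : g →ₗ[F] g →ₗ[F] V)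
    (x y : g) : liftCL₂ f (pure₂ F x y) = f x y := by
  simp [liftCL₂, pure₂_apply]

theorem CL₂_ext {V : Type*} [AddCommGroup V] [Module F V] {f f' : CL F g 2 →ₗ[F] V}
    (H : ∀ x y, f (pure₂ F x y) = f' (pure₂ F x y)) : f = f' := by
  refine PiTensorProduct.ext (MultilinearMap.ext fun v => ?_)
  have := H (v 0) (v 1)
  rwa [pure₂_apply, ← List.ofFn_inj.1 (by simp : List.ofFn v = List.ofFn ![v 0, v 1])] at this

/-- The map `f^{⊗ k}`. -/
def CLmap (f : g →ₗ[F] h) (k : ℕ) : CL F g k →ₗ[F] CL F h k := PiTensorProduct.map fun _ => f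

theorem CLmap_tprod (f : g →ₗ[F] h) (k : ℕ) (v : Fin k → g) :
    CLmap f k (PiTensorProduct.tprod F v) = PiTensorProduct.tprod F (f ∘ v) :=
  PiTensorProduct.map_tprod _ _

@[simp] theorem CLmap_pure₂ (f : g →ₗ[F] h) (x y : g) :
    CLmap f 2 (pure₂ F x y) = pure₂ F (f x) (f y) := by
  rw [pure₂_apply, CLmap_tprod, pure₂_apply]
  congr 1
  ext i
  fin_cases i <;> rfl

theorem CLmap_comp_apply {a b c : Type*} [AddCommGroup a] [Module F a] [AddCommGroup b]
    [Module F b] [AddCommGroup c] [Module F c] (f : b →ₗ[F] c) (f' : a →ₗ[F] b) (k : ℕ)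
    (t : CL F a k) : CLmap f k (CLmap f' k t) = CLmap (f ∘ₗ f') k t :=
  (LinearMap.congr_fun (PiTensorProduct.map_comp _ _) t).symm

theorem CLmap_id_apply {a : Type*} [AddCommGroup a] [Module F a] (k : ℕ) (t : CL F a k) :
    CLmap LinearMap.id k t = t :=
  LinearMap.congr_fun PiTensorProduct.map_id t

theorem CLmap_zero_two {a b : Type*} [AddCommGroup a] [Module F a] [AddCommGroup b]
    [Module F b] : CLmap (0 : a →ₗ[F] b) 2 = 0 :=
  CL₂_ext fun x y => by simp

theorem CLmap_surjective {f : g →ₗ[F] h} (hf : Function.Surjective f) (k : ℕ) :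
    Function.Surjective (CLmap f k) := by
  obtain ⟨s, hs⟩ := f.exists_rightInverse_of_surjective (LinearMap.range_eq_top.2 hf)
  refine fun t => ⟨CLmap s k t, ?_⟩
  rw [CLmap_comp_apply, hs, CLmap_id_apply]

/-- Tensoring a surjective map is, by splitting it, right exact in the following form: the kernel of
`f^{⊗ k}` is spanned by the pure tensors with at least one entry in the kernel of `f`. -/
theorem ker_CLmap {f : g →ₗ[F] h} (hf : Function.Surjective f) (k : ℕ) :
    LinearMap.ker (CLmap f k) =
      Submodule.span F {t | ∃ v : Fin k → g, (∃ i, f (v i) = 0) ∧ t = PiTensorProduct.tprod F v} := by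
  apply le_antisymm
  · obtain ⟨s, hs⟩ := f.exists_rightInverse_of_surjective (LinearMap.range_eq_top.2 hf)
    have hs' (y : h) : f (s y) = y := LinearMap.congr_fun hs y
    set S := Submodule.span F
      {t | ∃ v : Fin k → g, (∃ i, f (v i) = 0) ∧ t = PiTensorProduct.tprod F v}
    have key : S.mkQ ∘ₗ CLmap s k ∘ₗ CLmap f k = S.mkQ := by
      refine PiTensorProduct.ext (MultilinearMap.ext fun v => ?_)
      simp only [LinearMap.compMultilinearMap_apply, LinearMap.comp_apply, CLmap_tprod,
        Submodule.mkQ_apply]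
      rw [eq_comm, Submodule.Quotient.eq]
      have := (PiTensorProduct.tprod F).map_sub_map_piecewise v (s ∘ f ∘ v) Finset.univ
      simp only [Finset.piecewise_univ, Finset.mem_univ, true_imp_iff] at this
      rw [this]
      refine Submodule.sum_mem _ fun i _ => Submodule.subset_span ⟨_, ⟨i, ?_⟩, rfl⟩
      simp [hs']
    intro t ht
    have := LinearMap.congr_fun key t
    rw [LinearMap.comp_apply, LinearMap.comp_apply, LinearMap.mem_ker.1 ht, map_zero, map_zero,
      eq_comm] at this
    simpa using this
  · refine Submodule.span_le.2 ?_
    rintro _ ⟨v, ⟨i, hi⟩, rfl⟩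
    rw [SetLike.mem_coe, LinearMap.mem_ker, CLmap_tprod]
    exact (PiTensorProduct.tprod F).map_coord_zero i hi

/-- The projection `(x, y) ↦ (x, 0)` of `g₁ ⊕ g₂`. -/
def projLeft (F : Type*) [Field F] (g₁ g₂ : Type*) [AddCommGroup g₁] [Module F g₁]
    [AddCommGroup g₂] [Module F g₂] : g₁ × g₂ →ₗ[F] g₁ × g₂ :=
  LinearMap.inl F g₁ g₂ ∘ₗ LinearMap.fst F g₁ g₂

/-- The projection `(x, y) ↦ (0, y)` of `g₁ ⊕ g₂`. -/
def projRight (F : Type*) [Field F] (g₁ g₂ : Type*) [AddCommGroup g₁] [Module F g₁]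
    [AddCommGroup g₂] [Module F g₂] : g₁ × g₂ →ₗ[F] g₁ × g₂ :=
  LinearMap.inr F g₁ g₂ ∘ₗ LinearMap.snd F g₁ g₂

theorem pure₂_eq_sum {g₁ g₂ : Type*} [AddCommGroup g₁] [Module F g₁] [AddCommGroup g₂]
    [Module F g₂] (u v : g₁ × g₂) : pure₂ F u v =
    pure₂ F (u.1, 0) (0, v.2) + pure₂ F (0, u.2) (v.1, 0) +
      CLmap (projLeft F g₁ g₂) 2 (pure₂ F u v) + CLmap (projRight F g₁ g₂) 2 (pure₂ F u v) := by
  have hu : u = (u.1, 0) + (0, u.2) := by simp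
  have hv : v = (v.1, 0) + (0, v.2) := by simp
  conv_lhs => rw [hu, hv]
  simp only [CLmap_pure₂, map_add, LinearMap.add_apply]
  change _ = _ + pure₂ F (u.1, 0) (v.1, 0) + pure₂ F (0, u.2) (0, v.2)
  abel

end Chains

/-! ### The Leibniz boundary map in low degrees -/

section Boundary

variable {F : Type*} [Field F] {g h : Type*} [AddCommGroup g] [Module F g] [LeibnizAlgebra F g]
  [AddCommGroup h] [Module F h] [LeibnizAlgebra F h]

theorem boundary_one (x y : g) : boundary F g 1 (pure₂ F x y) = pure₁ F (br F x y) := by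
  simp [boundary, pure₂_apply, pure₁_apply, face, Fin.sum_univ_succ]
  congr 1
  ext i
  fin_cases i
  simp

theorem boundary_two (v : Fin 3 → g) : boundary F g 2 (PiTensorProduct.tprod F v) =
    pure₂ F (br F (v 0) (v 1)) (v 2) - pure₂ F (br F (v 0) (v 2)) (v 1) -
      pure₂ F (v 0) (br F (v 1) (v 2)) := by
  have e₁ (a : g) : Function.update (Fin.removeNth 1 v) 0 a = ![a, v 2] := by
    ext i; fin_cases i <;> rfl
  have e₂ (a : g) : Function.update (Fin.removeNth 2 v) 0 a = ![a, v 1] := by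
    ext i; fin_cases i <;> rfl
  have e₃ (a : g) : Function.update (Fin.removeNth 2 v) 1 a = ![v 0, a] := by
    ext i; fin_cases i <;> rfl
  simp [boundary, pure₂_apply, face, Fin.sum_univ_succ, e₁, e₂, e₃]
  module

theorem boundary_three (v : Fin 4 → g) : boundary F g 3 (PiTensorProduct.tprod F v) =
    PiTensorProduct.tprod F ![br F (v 0) (v 1), v 2, v 3]
    - PiTensorProduct.tprod F ![br F (v 0) (v 2), v 1, v 3]
    - PiTensorProduct.tprod F ![v 0, br F (v 1) (v 2), v 3]
    + PiTensorProduct.tprod F ![br F (v 0) (v 3), v 1, v 2]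
    + PiTensorProduct.tprod F ![v 0, br F (v 1) (v 3), v 2]
    + PiTensorProduct.tprod F ![v 0, v 1, br F (v 2) (v 3)] := by
  have e₁ (a : g) : Function.update (Fin.removeNth 1 v) 0 a = ![a, v 2, v 3] := by
    ext i; fin_cases i <;> rfl
  have e₂ (a : g) : Function.update (Fin.removeNth 2 v) 0 a = ![a, v 1, v 3] := by
    ext i; fin_cases i <;> rfl
  have e₃ (a : g) : Function.update (Fin.removeNth 2 v) 1 a = ![v 0, a, v 3] := by
    ext i; fin_cases i <;> rfl
  have e₄ (a : g) : Function.update (Fin.removeNth 3 v) 0 a = ![a, v 1, v 2] := by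
    ext i; fin_cases i <;> rfl
  have e₅ (a : g) : Function.update (Fin.removeNth 3 v) 1 a = ![v 0, a, v 2] := by
    ext i; fin_cases i <;> rfl
  have e₆ (a : g) : Function.update (Fin.removeNth 3 v) 2 a = ![v 0, v 1, a] := by
    ext i; fin_cases i <;> rfl
  have e₇ : Fin.succAbove (3 : Fin 4) 2 = 2 := rfl
  simp [boundary, face, Fin.sum_univ_succ, e₁, e₂, e₃, e₄, e₅, e₆, e₇]
  module

theorem boundary_one_two (t : CL F g 3) : boundary F g 1 (boundary F g 2 t) = 0 := by
  suffices H : boundary F g 1 ∘ₗ boundary F g 2 = 0 from LinearMap.congr_fun H t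
  refine PiTensorProduct.ext (MultilinearMap.ext fun v => ?_)
  simp [boundary_two, boundary_one, LeibnizAlgebra.leibniz]

theorem boundary_two_three (t : CL F g 4) : boundary F g 2 (boundary F g 3 t) = 0 := by
  suffices H : boundary F g 2 ∘ₗ boundary F g 3 = 0 from LinearMap.congr_fun H t
  refine PiTensorProduct.ext (MultilinearMap.ext fun v => ?_)
  simp [boundary_two, boundary_three, LeibnizAlgebra.leibniz]
  abel

theorem CLmap_boundary {f : g →ₗ[F] h} (hf : ∀ x y, f (br F x y) = br F (f x) (f y)) (k : ℕ)
    (t : CL F g (k + 1)) : CLmap f k (boundary F g k t) = boundary F h k (CLmap f (k + 1) t) := by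
  suffices H : CLmap f k ∘ₗ boundary F g k = boundary F h k ∘ₗ CLmap f (k + 1) from
    LinearMap.congr_fun H t
  have face_comp (v : Fin (k + 1) → g) (j : Fin (k + 1)) (i : Fin k) :
      CLmap f k (face F j i v) = face F j i (f ∘ v) := by
    simp only [face, MultilinearMap.mk'_apply, CLmap_tprod, Function.comp_update, hf]
    rfl
  refine PiTensorProduct.ext (MultilinearMap.ext fun v => ?_)
  simp only [LinearMap.compMultilinearMap_apply, LinearMap.comp_apply, CLmap_tprod, boundary,
    PiTensorProduct.lift.tprod, sum_apply]
  simp only [map_sum]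
  refine Finset.sum_congr rfl fun j _ => Finset.sum_congr rfl fun i _ => ?_
  split_ifs
  · simp only [smul_apply, map_smul, face_comp]
  · simp only [zero_apply, map_zero]

end Boundary

/-! ### Relative homology as the homology of the kernel complex -/

section HomologyClass

variable {F : Type*} [Field F] {A B C : Type*} [AddCommGroup A] [Module F A]
  [AddCommGroup B] [Module F B] [AddCommGroup C] [Module F C]
variable (d' : A →ₗ[F] B) (d : B →ₗ[F] C)

/-- The homology class of a cycle. -/
def homologyClass : LinearMap.ker d →ₗ[F] HomologyAt d' d :=
  ((LinearMap.range d').comap (LinearMap.ker d).subtype).mkQ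

theorem homologyClass_surjective : Function.Surjective (homologyClass d' d) :=
  Submodule.mkQ_surjective _

theorem homologyClass_eq_zero {x : LinearMap.ker d} :
    homologyClass d' d x = 0 ↔ (x : B) ∈ LinearMap.range d' :=
  Submodule.Quotient.mk_eq_zero _

end HomologyClass

section RelativeCycles

variable {F : Type*} [Field F] {g : Type*} [AddCommGroup g] [Module F g] [LeibnizAlgebra F g]
variable (n : LeibnizIdeal F g)

/-- The chains of the pair in degree `k`: the kernel of `CL_k(g) → CL_k(g / n)`. -/
def relChains (k : ℕ) : Submodule F (CL F g k) := LinearMap.ker (projChain n k)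

/-- Cycles of degree two in the kernel complex of `CL_*(g) → CL_*(g / n)`. -/
def relCycles : Submodule F (CL F g 2) := relChains n 2 ⊓ LinearMap.ker (boundary F g 1)

/-- Boundaries of degree two in the kernel complex of `CL_*(g) → CL_*(g / n)`. -/
def relBoundaries : Submodule F (CL F g 2) := (relChains n 3).map (boundary F g 2)

theorem relChains_eq_span (k : ℕ) : relChains n k = Submodule.span F
    {t | ∃ v : Fin k → g, (∃ i, v i ∈ n.toSubmodule) ∧ t = PiTensorProduct.tprod F v} := by
  have := ker_CLmap (F := F) n.toSubmodule.mkQ_surjective k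
  simp only [Submodule.mkQ_apply, Submodule.Quotient.mk_eq_zero] at this
  exact this

theorem projChain_boundary (k : ℕ) (t : CL F g (k + 1)) :
    projChain n k (boundary F g k t) =
      boundary F (g ⧸ n.toSubmodule) k (projChain n (k + 1) t) :=
  CLmap_boundary (f := n.toSubmodule.mkQ) (fun _ _ => rfl) k t

theorem projChain_surjective (k : ℕ) : Function.Surjective (projChain n k) :=
  CLmap_surjective n.toSubmodule.mkQ_surjective k

/-- A cycle `a` of the kernel complex as the cycle `(a, 0)` of the mapping cone. -/
def relCyclesToCone : relCycles n →ₗ[F] LinearMap.ker (coneBoundary n 1) :=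
  (LinearMap.inl F _ _ ∘ₗ (relCycles n).subtype).codRestrict _ (by
    rintro ⟨a, h₁, h₂⟩
    have h₁' : projChain n 2 a = 0 := h₁
    have h₂' : boundary F g 1 a = 0 := h₂
    simp [coneBoundary, h₁', h₂'])

theorem relCyclesToCone_coe (a : relCycles n) :
    (relCyclesToCone n a : CL F g 2 × CL F (g ⧸ n.toSubmodule) 3) = ((a : CL F g 2), 0) := rfl

/-- The map from cycles of the kernel complex to `HL₂(g, n)`. -/
def relCyclesToHL₂ : relCycles n →ₗ[F] HomologyAt (coneBoundary n 2) (coneBoundary n 1) :=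
  homologyClass (coneBoundary n 2) (coneBoundary n 1) ∘ₗ relCyclesToCone n

theorem relCyclesToHL₂_surjective : Function.Surjective (relCyclesToHL₂ n) := by
  intro z
  obtain ⟨⟨⟨a, b⟩, hab⟩, rfl⟩ :=
    homologyClass_surjective (coneBoundary n 2) (coneBoundary n 1) z
  -- With `b` lifted to `CL₃(g)`, subtracting the boundary of `(b, 0)` removes the second component.
  obtain ⟨b, rfl⟩ := projChain_surjective n 3 b
  have hab' : -(boundary F g 1 a) = 0 ∧
      boundary F (g ⧸ n.toSubmodule) 2 (projChain n 3 b) + projChain n 2 a = 0 := by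
    simpa [coneBoundary] using hab
  refine ⟨⟨a + boundary F g 2 b, ?_, ?_⟩, ?_⟩
  · change projChain n 2 _ = 0
    rw [map_add, projChain_boundary, add_comm, hab'.2]
  · change boundary F g 1 _ = 0
    rw [map_add, boundary_one_two, add_zero, neg_eq_zero.1 hab'.1]
  · rw [relCyclesToHL₂, LinearMap.comp_apply, ← sub_eq_zero, ← map_sub, homologyClass_eq_zero]
    refine ⟨(-b, 0), ?_⟩
    rw [AddSubgroupClass.coe_sub, relCyclesToCone_coe]
    simp [coneBoundary]

theorem ker_relCyclesToHL₂ :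
    LinearMap.ker (relCyclesToHL₂ n) = (relBoundaries n).comap (relCycles n).subtype := by
  ext ⟨a, ha⟩
  have h₀ : (⟨a, ha⟩ : relCycles n) ∈ LinearMap.ker (relCyclesToHL₂ n) ↔
      ((a, 0) : CL F g 2 × CL F (g ⧸ n.toSubmodule) 3) ∈ LinearMap.range (coneBoundary n 2) :=
    homologyClass_eq_zero _ _
  rw [h₀, Submodule.mem_comap]
  constructor
  · rintro ⟨⟨a', b'⟩, h⟩
    -- With `b'` lifted to `CL₄(g)`, the chain `a' + ∂ b'` is relative and has the same boundary
    -- as `a'`.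
    obtain ⟨b', rfl⟩ := projChain_surjective n 4 b'
    have h' : -(boundary F g 2 a') = a ∧
        boundary F (g ⧸ n.toSubmodule) 3 (projChain n 4 b') + projChain n 3 a' = 0 := by
      simpa [coneBoundary] using h
    refine ⟨-(a' + boundary F g 3 b'), ?_, ?_⟩
    · change projChain n 3 _ = 0
      rw [map_neg, map_add, projChain_boundary, add_comm, h'.2, neg_zero]
    · rw [map_neg, map_add, boundary_two_three, add_zero]
      exact h'.1
  · rintro ⟨a', ha', h⟩
    have ha'' : projChain n 3 a' = 0 := ha'
    refine ⟨(-a', 0), ?_⟩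
    simpa [coneBoundary, ha''] using h

/-- As `CL_*(g) → CL_*(g / n)` is onto, its mapping cone has the homology of its kernel, shifted by
one: `HL₂(g, n)` is the second homology of the kernel complex. -/
def HL₂Equiv : (relCycles n ⧸ (relBoundaries n).comap (relCycles n).subtype) ≃ₗ[F] HL₂ n :=
  (Submodule.quotEquivOfEq _ _ (ker_relCyclesToHL₂ n).symm).trans
    ((relCyclesToHL₂ n).quotKerEquivOfSurjective (relCyclesToHL₂_surjective n))

end RelativeCycles

/-! ### Generators of relative chains and boundaries -/

section Generators

variable {F : Type*} [Field F] {g : Type*} [AddCommGroup g] [Module F g] [LeibnizAlgebra F g]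
variable {n : LeibnizIdeal F g}

theorem pure₂_mem_relChains {x y : g} (hxy : x ∈ n.toSubmodule ∨ y ∈ n.toSubmodule) :
    pure₂ F x y ∈ relChains n 2 := by
  rw [relChains_eq_span]
  refine Submodule.subset_span ⟨![x, y], ?_, rfl⟩
  rcases hxy with hx | hy
  · exact ⟨0, hx⟩
  · exact ⟨1, hy⟩

/-- To prove `relChains n 2 ≤ S` it suffices to check the tensors `x ⊗ y` with an entry in `n`. -/
theorem relChains_two_le {S : Submodule F (CL F g 2)}
    (H : ∀ x y : g, x ∈ n.toSubmodule ∨ y ∈ n.toSubmodule → pure₂ F x y ∈ S) :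
    relChains n 2 ≤ S := by
  rw [relChains_eq_span]
  refine Submodule.span_le.2 ?_
  rintro _ ⟨v, hv, rfl⟩
  have e : v = ![v 0, v 1] := by ext i; fin_cases i <;> rfl
  rw [e]
  refine H _ _ ?_
  simpa [Fin.exists_fin_two] using hv

theorem boundary_mem_relBoundaries {x y z : g}
    (h : x ∈ n.toSubmodule ∨ y ∈ n.toSubmodule ∨ z ∈ n.toSubmodule) :
    pure₂ F (br F x y) z - pure₂ F (br F x z) y - pure₂ F x (br F y z) ∈ relBoundaries n := by
  refine ⟨PiTensorProduct.tprod F ![x, y, z], ?_, boundary_two _⟩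
  rw [SetLike.mem_coe, relChains_eq_span]
  refine Submodule.subset_span ⟨_, ?_, rfl⟩
  rcases h with h | h | h
  · exact ⟨0, h⟩
  · exact ⟨1, h⟩
  · exact ⟨2, h⟩

theorem relBoundaries_le {S : Submodule F (CL F g 2)}
    (H : ∀ x y z : g, x ∈ n.toSubmodule ∨ y ∈ n.toSubmodule ∨ z ∈ n.toSubmodule →
      pure₂ F (br F x y) z - pure₂ F (br F x z) y - pure₂ F x (br F y z) ∈ S) :
    relBoundaries n ≤ S := by
  rw [relBoundaries, relChains_eq_span, Submodule.map_span_le]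
  rintro _ ⟨v, hv, rfl⟩
  rw [boundary_two]
  refine H _ _ _ ?_
  simpa [Fin.exists_fin_succ] using hv

variable {h : Type*} [AddCommGroup h] [Module F h] [LeibnizAlgebra F h] {m : LeibnizIdeal F h}
variable {f : g →ₗ[F] h}

theorem CLmap_mem_relChains (hn : ∀ x ∈ n.toSubmodule, f x ∈ m.toSubmodule) (k : ℕ) {t : CL F g k}
    (ht : t ∈ relChains n k) : CLmap f k t ∈ relChains m k := by
  rw [relChains_eq_span] at ht
  suffices H : Submodule.span F _ ≤ (relChains m k).comap (CLmap f k) from H ht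
  rw [relChains_eq_span]
  refine Submodule.span_le.2 ?_
  rintro _ ⟨v, ⟨i, hi⟩, rfl⟩
  exact Submodule.subset_span ⟨f ∘ v, ⟨i, hn _ hi⟩, CLmap_tprod f k v⟩

theorem CLmap_mem_relCycles (hf : ∀ x y, f (br F x y) = br F (f x) (f y))
    (hn : ∀ x ∈ n.toSubmodule, f x ∈ m.toSubmodule) {t : CL F g 2} (ht : t ∈ relCycles n) :
    CLmap f 2 t ∈ relCycles m := by
  have ht₂ : boundary F g 1 t = 0 := ht.2
  refine ⟨CLmap_mem_relChains hn 2 ht.1, ?_⟩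
  change boundary F h 1 _ = 0
  rw [← CLmap_boundary hf, ht₂, map_zero]

theorem CLmap_mem_relBoundaries (hf : ∀ x y, f (br F x y) = br F (f x) (f y))
    (hn : ∀ x ∈ n.toSubmodule, f x ∈ m.toSubmodule) {t : CL F g 2} (ht : t ∈ relBoundaries n) :
    CLmap f 2 t ∈ relBoundaries m := by
  obtain ⟨s, hs, rfl⟩ := ht
  exact ⟨CLmap f 3 s, CLmap_mem_relChains hn 3 hs, (CLmap_boundary hf 2 s).symm⟩

end Generators

/-! ### Linear maps out of a trivial-action tensor product -/

section QuotientBilinear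

variable {F : Type*} [Field F] {A B V : Type*} [AddCommGroup A] [Module F A]
  [AddCommGroup B] [Module F B] [AddCommGroup V] [Module F V]

/-- A bilinear map that vanishes on `I` in the first and on `J` in the second variable descends to
the quotients. -/
def liftQ₂ (I : Submodule F A) (J : Submodule F B) (f : A →ₗ[F] B →ₗ[F] V)
    (hI : ∀ a ∈ I, ∀ b, f a b = 0) (hJ : ∀ a, ∀ b ∈ J, f a b = 0) :
    (A ⧸ I) →ₗ[F] (B ⧸ J) →ₗ[F] V :=
  I.liftQ (J.liftQ f.flip fun b hb => LinearMap.ext fun a => hJ a b hb).flip fun a ha => by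
    ext b
    exact hI a ha b

@[simp] theorem liftQ₂_mkQ (I : Submodule F A) (J : Submodule F B) (f : A →ₗ[F] B →ₗ[F] V)
    (hI : ∀ a ∈ I, ∀ b, f a b = 0) (hJ : ∀ a, ∀ b ∈ J, f a b = 0) (a : A) (b : B) :
    liftQ₂ I J f hI hJ (I.mkQ a) (J.mkQ b) = f a b :=
  rfl

end QuotientBilinear

section PresentedLift

variable {F : Type*} [Field F] {X V : Type*} [AddCommGroup V] [Module F V]

/-- The extension by zero of a function on `X` to all words of the free magma. -/
def wordLift (f : X → V) : FreeMagma X → V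
  | .of x => f x
  | .mul _ _ => 0

/-- The linear map on the free non-associative algebra that takes prescribed values on the
generators and vanishes on all products. -/
def genLift (f : X → V) : FreeNonUnitalNonAssocAlgebra F X →ₗ[F] V :=
  Finsupp.linearCombination F (wordLift f) ∘ₗ (MonoidAlgebra.coeffLinearEquiv F).toLinearMap

theorem genLift_single (f : X → V) (a : FreeMagma X) :
    genLift f (MonoidAlgebra.single a 1 : FreeNonUnitalNonAssocAlgebra F X) = wordLift f a := by
  simp [genLift]

theorem genLift_of (f : X → V) (x : X) :
    genLift (F := F) f (FreeNonUnitalNonAssocAlgebra.of F x) = f x :=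
  genLift_single f (FreeMagma.of x)

theorem genLift_mul (f : X → V) (a b : FreeNonUnitalNonAssocAlgebra F X) :
    genLift f (a * b) = 0 := by
  have h : (LinearMap.mul F (FreeNonUnitalNonAssocAlgebra F X)).compr₂ (genLift f) = 0 := by
    refine MonoidAlgebra.lhom_ext' fun a => LinearMap.ext_ring ?_
    refine MonoidAlgebra.lhom_ext' fun b => LinearMap.ext_ring ?_
    change genLift f ((MonoidAlgebra.single a 1 : FreeNonUnitalNonAssocAlgebra F X) *
      MonoidAlgebra.single b 1) = 0
    rw [MonoidAlgebra.single_mul_single, one_mul, genLift_single]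
    rfl
  exact LinearMap.congr_fun₂ h a b

/-- A map on the generators that respects the relations modulo all products extends to a linear map
on the presented Leibniz algebra. -/
def Presented.lift (r : FreeNonUnitalNonAssocAlgebra F X → FreeNonUnitalNonAssocAlgebra F X → Prop)
    (f : X → V) (hf : ∀ a b, r a b → genLift f a = genLift f b) : Presented r →ₗ[F] V :=
  (relIdeal r).liftQ (genLift f) (sInf_le ⟨fun a b hab => by
      rw [LinearMap.mem_ker, map_sub, hf a b hab, sub_self],
    fun a b c => by simp [genLift_mul],
    fun a x _ => ⟨genLift_mul f a x, genLift_mul f x a⟩⟩)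

theorem Presented.lift_gen
    (r : FreeNonUnitalNonAssocAlgebra F X → FreeNonUnitalNonAssocAlgebra F X → Prop)
    (f : X → V) (hf : ∀ a b, r a b → genLift f a = genLift f b) (x : X) :
    Presented.lift r f hf (Presented.gen r x) = f x :=
  genLift_of f x

/-- A presented algebra with zero bracket is spanned by its generators. -/
theorem Presented.span_gen
    (r : FreeNonUnitalNonAssocAlgebra F X → FreeNonUnitalNonAssocAlgebra F X → Prop)
    (h : ∀ u v : Presented r, br F u v = 0) :
    Submodule.span F (Set.range (Presented.gen r)) = ⊤ := by
  rw [eq_top_iff]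
  rintro u -
  obtain ⟨a, rfl⟩ := Presented.mk_surjective r u
  suffices H : (Submodule.span F (Set.range (Presented.gen r))).mkQ ∘ₗ Presented.mk r = 0 by
    simpa using LinearMap.congr_fun H a
  refine MonoidAlgebra.lhom_ext' fun a => LinearMap.ext_ring ?_
  induction a using FreeMagma.recOnMul with
  | ih1 x => exact (Submodule.Quotient.mk_eq_zero _).2 (Submodule.subset_span ⟨x, rfl⟩)
  | ih2 a b _ _ =>
    have e : (MonoidAlgebra.single (a * b) 1 : FreeNonUnitalNonAssocAlgebra F X) =
        MonoidAlgebra.single a 1 * MonoidAlgebra.single b 1 := by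
      rw [MonoidAlgebra.single_mul_single, one_mul]
    have e' : Presented.mk r (MonoidAlgebra.single (a * b) 1) = 0 := by
      rw [e, ← Presented.br_mk, h]
    refine (Submodule.Quotient.mk_eq_zero _).2 ?_
    change Presented.mk r (MonoidAlgebra.single (a * b) 1) ∈ _
    rw [e']
    exact Submodule.zero_mem _

end PresentedLift

section TrivTensorLift

variable {F : Type*} [Field F] {m n V : Type*}
  [AddCommGroup m] [Module F m] [LeibnizAlgebra F m]
  [AddCommGroup n] [Module F n] [LeibnizAlgebra F n] [AddCommGroup V] [Module F V]

/-- The generators `a ∗ b` as a bilinear map. -/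
def tmulLHom (F : Type*) [Field F] (m n : Type*)
    [AddCommGroup m] [Module F m] [LeibnizAlgebra F m]
    [AddCommGroup n] [Module F n] [LeibnizAlgebra F n] : m →ₗ[F] n →ₗ[F] TrivTensor F m n :=
  LinearMap.mk₂ F (tmulL F)
    (fun a a' b => Presented.mk_eq _ (TensorRel.addL₁ a a' b))
    (fun c a b => (Presented.mk_eq _ (TensorRel.smulL₁ c a b)).symm)
    (fun a b b' => Presented.mk_eq _ (TensorRel.addL₂ a b b'))
    (fun c a b => (Presented.mk_eq _ (TensorRel.smulL₂ c a b)).symm)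

/-- The generators `b ∗ a` as a bilinear map. -/
def tmulRHom (F : Type*) [Field F] (m n : Type*)
    [AddCommGroup m] [Module F m] [LeibnizAlgebra F m]
    [AddCommGroup n] [Module F n] [LeibnizAlgebra F n] : n →ₗ[F] m →ₗ[F] TrivTensor F m n :=
  LinearMap.mk₂ F (tmulR F)
    (fun b b' a => Presented.mk_eq _ (TensorRel.addR₁ b b' a))
    (fun c b a => (Presented.mk_eq _ (TensorRel.smulR₁ c b a)).symm)
    (fun b a a' => Presented.mk_eq _ (TensorRel.addR₂ b a a'))
    (fun c b a => (Presented.mk_eq _ (TensorRel.smulR₂ c b a)).symm)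

theorem tmulLHom_apply (a : m) (b : n) : tmulLHom F m n a b = tmulL F a b := rfl

theorem tmulRHom_apply (b : n) (a : m) : tmulRHom F m n b a = tmulR F b a := rfl

/-- For abelian `m` and `n` the algebra `m ∗ n` (with trivial actions) has the universal property of
the vector space `(m ⊗ n) ⊕ (n ⊗ m)`. -/
def TrivTensor.lift (hm : ∀ a a' : m, br F a a' = 0) (hn : ∀ b b' : n, br F b b' = 0)
    (p : m →ₗ[F] n →ₗ[F] V) (q : n →ₗ[F] m →ₗ[F] V) : TrivTensor F m n →ₗ[F] V :=
  Presented.lift _ (Sum.elim (fun x => p x.1 x.2) (fun x => q x.1 x.2)) (by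
    intro a b hab
    cases hab <;>
      simp [symL, symR, genLift_of, genLift_mul, LeibnizAction.trivial, hm, hn])

@[simp] theorem TrivTensor.lift_tmulL (hm : ∀ a a' : m, br F a a' = 0)
    (hn : ∀ b b' : n, br F b b' = 0) (p : m →ₗ[F] n →ₗ[F] V) (q : n →ₗ[F] m →ₗ[F] V)
    (a : m) (b : n) : TrivTensor.lift hm hn p q (tmulL F a b) = p a b :=
  Presented.lift_gen _ _ _ (Sum.inl (a, b))

@[simp] theorem TrivTensor.lift_tmulR (hm : ∀ a a' : m, br F a a' = 0)
    (hn : ∀ b b' : n, br F b b' = 0) (p : m →ₗ[F] n →ₗ[F] V) (q : n →ₗ[F] m →ₗ[F] V)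
    (b : n) (a : m) : TrivTensor.lift hm hn p q (tmulR F b a) = q b a :=
  Presented.lift_gen _ _ _ (Sum.inr (b, a))

theorem TrivTensor.mem_of_generators {S : Submodule F (TrivTensor F m n)}
    (hL : ∀ a b, tmulL F a b ∈ S) (hR : ∀ b a, tmulR F b a ∈ S) (u : TrivTensor F m n) : u ∈ S := by
  have h := Presented.span_gen (TensorRel (LeibnizAction.trivial F m n)
    (LeibnizAction.trivial F n m)) TrivTensor.br_eq_zero
  suffices H : (⊤ : Submodule F (TrivTensor F m n)) ≤ S from H trivial
  rw [← h, Submodule.span_le]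
  rintro _ ⟨⟨a, b⟩ | ⟨b, a⟩, rfl⟩
  · exact hL a b
  · exact hR b a

end TrivTensorLift

/-! ### The quotients `n̄` and `ḡ` -/

section Abelian

variable {F : Type*} [Field F] {g : Type*} [AddCommGroup g] [Module F g] [LeibnizAlgebra F g]

theorem toAb_br (x y : g) : toAb F (br F x y) = 0 :=
  (Submodule.Quotient.mk_eq_zero _).2 (Submodule.subset_span ⟨x, y, trivial, Or.inl rfl⟩)

theorem Ab.br_eq_zero (u v : Ab F g) : br F u v = 0 := by
  obtain ⟨x, rfl⟩ := Submodule.mkQ_surjective _ u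
  obtain ⟨y, rfl⟩ := Submodule.mkQ_surjective _ v
  exact toAb_br x y

namespace LeibnizIdeal

variable (n : LeibnizIdeal F g)

theorem toBar_br_left (x : g) {a : g} (ha : a ∈ n.toSubmodule) :
    n.toBar ⟨br F x a, n.br_mem_left x ha⟩ = 0 :=
  (Submodule.Quotient.mk_eq_zero _).2 (Submodule.subset_span ⟨x, a, ha, Or.inl rfl⟩)

theorem toBar_br_right {a : g} (x : g) (ha : a ∈ n.toSubmodule) :
    n.toBar ⟨br F a x, n.br_mem_right x ha⟩ = 0 :=
  (Submodule.Quotient.mk_eq_zero _).2 (Submodule.subset_span ⟨x, a, ha, Or.inr rfl⟩)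

theorem Bar.br_eq_zero (u v : n.Bar) : br F u v = 0 := by
  obtain ⟨x, rfl⟩ := Submodule.mkQ_surjective _ u
  obtain ⟨y, rfl⟩ := Submodule.mkQ_surjective _ v
  exact toBar_br_left n x y.2

/-- A linear retraction of `g` onto `n`, which exists because `F` is a field. -/
def retraction : g →ₗ[F] n.toSubmodule :=
  Classical.choose (n.toSubmodule.subtype.exists_leftInverse_of_injective
    (Submodule.ker_subtype n.toSubmodule))

theorem retraction_of_mem {a : g} (ha : a ∈ n.toSubmodule) : n.retraction a = ⟨a, ha⟩ :=
  LinearMap.congr_fun (Classical.choose_spec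
    (n.toSubmodule.subtype.exists_leftInverse_of_injective
      (Submodule.ker_subtype n.toSubmodule))) ⟨a, ha⟩

/-- The linear map `g → n̄` that extends the class map of `n` along the retraction. -/
def extBar : g →ₗ[F] n.Bar := n.toBar ∘ₗ n.retraction

/-- The linear map `g → ḡ` that agrees with the class map on a complement of `n` and vanishes on
`n`. -/
def complAb : g →ₗ[F] Ab F g := toAb F ∘ₗ (LinearMap.id - n.toSubmodule.subtype ∘ₗ n.retraction)

theorem extBar_of_mem {a : g} (ha : a ∈ n.toSubmodule) : n.extBar a = n.toBar ⟨a, ha⟩ := by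
  rw [extBar, LinearMap.comp_apply, retraction_of_mem n ha]

theorem complAb_of_mem {a : g} (ha : a ∈ n.toSubmodule) : n.complAb a = 0 := by
  simp [complAb, retraction_of_mem n ha]

theorem complAb_apply (x : g) : n.complAb x = toAb F x - toAb F (n.retraction x : g) := by
  simp [complAb]

end LeibnizIdeal

end Abelian

/-! ### The mixed part of a relative chain -/

section MixedTermClass

variable {F : Type*} [Field F] {g₁ g₂ : Type*}
  [AddCommGroup g₁] [Module F g₁] [LeibnizAlgebra F g₁]
  [AddCommGroup g₂] [Module F g₂] [LeibnizAlgebra F g₂]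
  (n₁ : LeibnizIdeal F g₁) (n₂ : LeibnizIdeal F g₂)

theorem MixedTerm.br_eq_zero (u v : MixedTerm n₁ n₂) : br F u v = 0 := by
  obtain ⟨x, rfl⟩ := Submodule.mkQ_surjective _ u
  obtain ⟨y, rfl⟩ := Submodule.mkQ_surjective _ v
  refine (congrArg (mixedIdeal n₁ n₂).toSubmodule.mkQ (MixedSum.br_eq_zero n₁ n₂ x y)).trans ?_
  exact map_zero _

/-- The class of an element of `n̄₁ ∗ ḡ₂` in the mixed term. -/
def mixedInl : TrivTensor F n₁.Bar (Ab F g₂) →ₗ[F] MixedTerm n₁ n₂ :=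
  (mixedIdeal n₁ n₂).toSubmodule.mkQ ∘ₗ LinearMap.inl F _ _

/-- The class of an element of `ḡ₁ ∗ n̄₂` in the mixed term. -/
def mixedInr : TrivTensor F (Ab F g₁) n₂.Bar →ₗ[F] MixedTerm n₁ n₂ :=
  (mixedIdeal n₁ n₂).toSubmodule.mkQ ∘ₗ LinearMap.inr F _ _

theorem mem_mixedIdeal_of_mem_generators {z : MixedSum n₁ n₂} (hz : z ∈ mixedGenerators n₁ n₂) :
    z ∈ (mixedIdeal n₁ n₂).toSubmodule :=
  Submodule.mem_sInf.2 fun _ hS => hS.1 hz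

theorem mixedInl_tmulL (a₁ : n₁.toSubmodule) (a₂ : n₂.toSubmodule) :
    mixedInl n₁ n₂ (tmulL F (n₁.toBar a₁) (toAb F (a₂ : g₂))) =
      mixedInr n₁ n₂ (tmulL F (toAb F (a₁ : g₁)) (n₂.toBar a₂)) := by
  refine (Submodule.Quotient.eq _).2 ?_
  have := mem_mixedIdeal_of_mem_generators n₁ n₂ ⟨a₁, a₂, Or.inl rfl⟩
  simpa using this

theorem mixedInl_tmulR (a₁ : n₁.toSubmodule) (a₂ : n₂.toSubmodule) :
    mixedInl n₁ n₂ (tmulR F (toAb F (a₂ : g₂)) (n₁.toBar a₁)) =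
      mixedInr n₁ n₂ (tmulR F (n₂.toBar a₂) (toAb F (a₁ : g₁))) := by
  refine (Submodule.Quotient.eq _).2 ?_
  have := mem_mixedIdeal_of_mem_generators n₁ n₂ ⟨a₁, a₂, Or.inr rfl⟩
  simpa using this

theorem MixedTerm.mem_of_generators {S : Submodule F (MixedTerm n₁ n₂)}
    (h₁ : ∀ (a : n₁.toSubmodule) (b : g₂), mixedInl n₁ n₂ (tmulL F (n₁.toBar a) (toAb F b)) ∈ S)
    (h₂ : ∀ (b : g₂) (a : n₁.toSubmodule), mixedInl n₁ n₂ (tmulR F (toAb F b) (n₁.toBar a)) ∈ S)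
    (h₃ : ∀ (a : g₁) (b : n₂.toSubmodule), mixedInr n₁ n₂ (tmulL F (toAb F a) (n₂.toBar b)) ∈ S)
    (h₄ : ∀ (b : n₂.toSubmodule) (a : g₁), mixedInr n₁ n₂ (tmulR F (n₂.toBar b) (toAb F a)) ∈ S)
    (u : MixedTerm n₁ n₂) : u ∈ S := by
  obtain ⟨⟨x, y⟩, rfl⟩ := Submodule.mkQ_surjective _ u
  have hx : x ∈ S.comap (mixedInl n₁ n₂) := by
    refine TrivTensor.mem_of_generators (fun a b => ?_) (fun b a => ?_) x
    · obtain ⟨a, rfl⟩ := Submodule.mkQ_surjective _ a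
      obtain ⟨b, rfl⟩ := Submodule.mkQ_surjective _ b
      exact h₁ a b
    · obtain ⟨a, rfl⟩ := Submodule.mkQ_surjective _ a
      obtain ⟨b, rfl⟩ := Submodule.mkQ_surjective _ b
      exact h₂ b a
  have hy : y ∈ S.comap (mixedInr n₁ n₂) := by
    refine TrivTensor.mem_of_generators (fun a b => ?_) (fun b a => ?_) y
    · obtain ⟨a, rfl⟩ := Submodule.mkQ_surjective _ a
      obtain ⟨b, rfl⟩ := Submodule.mkQ_surjective _ b
      exact h₃ a b
    · obtain ⟨a, rfl⟩ := Submodule.mkQ_surjective _ a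
      obtain ⟨b, rfl⟩ := Submodule.mkQ_surjective _ b
      exact h₄ b a
  have e : (x, y) = LinearMap.inl F _ _ x + LinearMap.inr F _ _ y := by simp
  rw [e, map_add]
  exact S.add_mem hx hy

/-- The linear map `CL₂(g₁ ⊕ g₂) → ((n̄₁ ∗ ḡ₂) ⊕ (ḡ₁ ∗ n̄₂)) / 𝔞` that reads off the mixed part of a
relative chain. On `(n₁ ⊗ g₂) + (g₁ ⊗ n₂)` the obvious formulas on the two summands agree on the
intersection `n₁ ⊗ n₂` modulo `𝔞`. With linear retractions `ρᵢ` of `gᵢ` onto `nᵢ`, the map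
`x ⊗ y ↦ (ρ₁ x ∗ y, (x - ρ₁ x) ∗ ρ₂ y)` extends them to `g₁ ⊗ g₂`, and likewise for `g₂ ⊗ g₁`. -/
def mixedPart : CL F (g₁ × g₂) 2 →ₗ[F] MixedTerm n₁ n₂ :=
  liftCL₂
    (((tmulLHom F n₁.Bar (Ab F g₂)).compl₁₂ (n₁.extBar ∘ₗ LinearMap.fst F g₁ g₂)
        (toAb F ∘ₗ LinearMap.snd F g₁ g₂) +
      (tmulRHom F n₁.Bar (Ab F g₂)).compl₁₂ (toAb F ∘ₗ LinearMap.snd F g₁ g₂)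
        (n₁.extBar ∘ₗ LinearMap.fst F g₁ g₂)).compr₂ (mixedInl n₁ n₂) +
    ((tmulLHom F (Ab F g₁) n₂.Bar).compl₁₂ (n₁.complAb ∘ₗ LinearMap.fst F g₁ g₂)
        (n₂.extBar ∘ₗ LinearMap.snd F g₁ g₂) +
      (tmulRHom F (Ab F g₁) n₂.Bar).compl₁₂ (n₂.extBar ∘ₗ LinearMap.snd F g₁ g₂)
        (n₁.complAb ∘ₗ LinearMap.fst F g₁ g₂)).compr₂ (mixedInr n₁ n₂))

theorem mixedPart_pure₂ (u v : g₁ × g₂) : mixedPart n₁ n₂ (pure₂ F u v) =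
    mixedInl n₁ n₂ (tmulLHom F _ _ (n₁.extBar u.1) (toAb F v.2)) +
    mixedInl n₁ n₂ (tmulRHom F _ _ (toAb F u.2) (n₁.extBar v.1)) +
    (mixedInr n₁ n₂ (tmulLHom F _ _ (n₁.complAb u.1) (n₂.extBar v.2)) +
    mixedInr n₁ n₂ (tmulRHom F _ _ (n₂.extBar u.2) (n₁.complAb v.1))) := by
  rw [mixedPart, liftCL₂_pure₂, ← map_add, ← map_add]
  rfl

theorem mixedPart_of_mem_left {u : g₁ × g₂} (v : g₁ × g₂) (h₁ : u.1 ∈ n₁.toSubmodule)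
    (h₂ : u.2 ∈ n₂.toSubmodule) : mixedPart n₁ n₂ (pure₂ F u v) =
      mixedInl n₁ n₂ (tmulLHom F _ _ (n₁.toBar ⟨u.1, h₁⟩) (toAb F v.2)) +
      mixedInr n₁ n₂ (tmulRHom F _ _ (n₂.toBar ⟨u.2, h₂⟩) (toAb F v.1)) := by
  have h : mixedInl n₁ n₂ (tmulRHom F _ _ (toAb F u.2) (n₁.extBar v.1)) =
      mixedInr n₁ n₂ (tmulRHom F _ _ (n₂.toBar ⟨u.2, h₂⟩) (toAb F (n₁.retraction v.1 : g₁))) :=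
    mixedInl_tmulR n₁ n₂ (n₁.retraction v.1) ⟨u.2, h₂⟩
  rw [mixedPart_pure₂, n₁.extBar_of_mem h₁, n₂.extBar_of_mem h₂, n₁.complAb_of_mem h₁,
    n₁.complAb_apply, h]
  simp only [map_zero, LinearMap.zero_apply, map_sub]
  abel

theorem mixedPart_of_mem_right (u : g₁ × g₂) {v : g₁ × g₂} (h₁ : v.1 ∈ n₁.toSubmodule)
    (h₂ : v.2 ∈ n₂.toSubmodule) : mixedPart n₁ n₂ (pure₂ F u v) =
      mixedInl n₁ n₂ (tmulRHom F _ _ (toAb F u.2) (n₁.toBar ⟨v.1, h₁⟩)) +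
      mixedInr n₁ n₂ (tmulLHom F _ _ (toAb F u.1) (n₂.toBar ⟨v.2, h₂⟩)) := by
  have h : mixedInl n₁ n₂ (tmulLHom F _ _ (n₁.extBar u.1) (toAb F v.2)) =
      mixedInr n₁ n₂ (tmulLHom F _ _ (toAb F (n₁.retraction u.1 : g₁)) (n₂.toBar ⟨v.2, h₂⟩)) :=
    mixedInl_tmulL n₁ n₂ (n₁.retraction u.1) ⟨v.2, h₂⟩
  rw [mixedPart_pure₂, n₁.extBar_of_mem h₁, n₂.extBar_of_mem h₂, n₁.complAb_of_mem h₁,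
    n₁.complAb_apply, h]
  simp only [map_zero, map_sub, LinearMap.sub_apply]
  abel

theorem mixedPart_br_left {x y z : g₁ × g₂} (h : x ∈ (n₁.prod n₂).toSubmodule ∨
    y ∈ (n₁.prod n₂).toSubmodule ∨ z ∈ (n₁.prod n₂).toSubmodule) :
    mixedPart n₁ n₂ (pure₂ F (br F x y) z) = 0 := by
  -- The components of `br F x y` agree with the brackets of components only by unfolding the
  -- bracket of `g₁ × g₂`, hence `erw`.
  rcases h with ⟨h₁, h₂⟩ | ⟨h₁, h₂⟩ | ⟨h₁, h₂⟩
  · have e₁ := n₁.toBar_br_right y.1 h₁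
    have e₂ := n₂.toBar_br_right y.2 h₂
    refine (mixedPart_of_mem_left n₁ n₂ z (n₁.br_mem_right y.1 h₁)
      (n₂.br_mem_right y.2 h₂)).trans ?_
    erw [e₁, e₂]
    simp
  · have e₁ := n₁.toBar_br_left x.1 h₁
    have e₂ := n₂.toBar_br_left x.2 h₂
    refine (mixedPart_of_mem_left n₁ n₂ z (n₁.br_mem_left x.1 h₁)
      (n₂.br_mem_left x.2 h₂)).trans ?_
    erw [e₁, e₂]
    simp
  · have e₁ : toAb F (br F x y).1 = 0 := toAb_br x.1 y.1
    have e₂ : toAb F (br F x y).2 = 0 := toAb_br x.2 y.2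
    rw [mixedPart_of_mem_right n₁ n₂ _ h₁ h₂, e₁, e₂]
    simp

theorem mixedPart_br_right {x y z : g₁ × g₂} (h : x ∈ (n₁.prod n₂).toSubmodule ∨
    y ∈ (n₁.prod n₂).toSubmodule ∨ z ∈ (n₁.prod n₂).toSubmodule) :
    mixedPart n₁ n₂ (pure₂ F x (br F y z)) = 0 := by
  rcases h with ⟨h₁, h₂⟩ | ⟨h₁, h₂⟩ | ⟨h₁, h₂⟩
  · have e₁ : toAb F (br F y z).1 = 0 := toAb_br y.1 z.1
    have e₂ : toAb F (br F y z).2 = 0 := toAb_br y.2 z.2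
    rw [mixedPart_of_mem_left n₁ n₂ _ h₁ h₂, e₁, e₂]
    simp
  · have e₁ := n₁.toBar_br_right z.1 h₁
    have e₂ := n₂.toBar_br_right z.2 h₂
    refine (mixedPart_of_mem_right n₁ n₂ x (n₁.br_mem_right z.1 h₁)
      (n₂.br_mem_right z.2 h₂)).trans ?_
    erw [e₁, e₂]
    simp
  · have e₁ := n₁.toBar_br_left y.1 h₁
    have e₂ := n₂.toBar_br_left y.2 h₂
    refine (mixedPart_of_mem_right n₁ n₂ x (n₁.br_mem_left y.1 h₁)
      (n₂.br_mem_left y.2 h₂)).trans ?_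
    erw [e₁, e₂]
    simp

theorem mixedPart_of_mem_relBoundaries {t : CL F (g₁ × g₂) 2}
    (ht : t ∈ relBoundaries (n₁.prod n₂)) : mixedPart n₁ n₂ t = 0 := by
  suffices H : relBoundaries (n₁.prod n₂) ≤ LinearMap.ker (mixedPart n₁ n₂) from H ht
  refine relBoundaries_le fun x y z h => ?_
  have h' : x ∈ (n₁.prod n₂).toSubmodule ∨ z ∈ (n₁.prod n₂).toSubmodule ∨
      y ∈ (n₁.prod n₂).toSubmodule := by tauto
  rw [LinearMap.mem_ker, map_sub, map_sub, mixedPart_br_left n₁ n₂ h, mixedPart_br_left n₁ n₂ h',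
    mixedPart_br_right n₁ n₂ h, sub_zero, sub_zero]

end MixedTermClass

/-! ### From the mixed term back to chains -/

section CommutingElement

variable {F : Type*} [Field F] {g h : Type*} [AddCommGroup g] [Module F g] [LeibnizAlgebra F g]
  [AddCommGroup h] [Module F h] [LeibnizAlgebra F h]

/-- If `z` commutes with the image of `f` and each `f a ⊗ z` with `a` in the ideal `k` is a relative
chain, then `f c ⊗ z` and `z ⊗ f c` are relative boundaries for all `c ∈ [g, k]`: apply the boundary
map to `f x ⊗ f a ⊗ z` and to `z ⊗ f x ⊗ f a`. -/
theorem pure₂_mem_relBoundaries_of_mem_commSpan {m : LeibnizIdeal F h} {f : g →ₗ[F] h}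
    (hf : ∀ x y, f (br F x y) = br F (f x) (f y)) (k : LeibnizIdeal F g) {z : h}
    (hl : ∀ x, br F z (f x) = 0) (hr : ∀ x, br F (f x) z = 0)
    (hk : ∀ a ∈ k.toSubmodule, f a ∈ m.toSubmodule ∨ z ∈ m.toSubmodule) {c : g}
    (hc : c ∈ k.commSpan) :
    pure₂ F (f c) z ∈ relBoundaries m ∧ pure₂ F z (f c) ∈ relBoundaries m := by
  have key (x y : g) (h : f x ∈ m.toSubmodule ∨ f y ∈ m.toSubmodule ∨ z ∈ m.toSubmodule) :
      pure₂ F (f (br F x y)) z ∈ relBoundaries m ∧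
        pure₂ F z (f (br F x y)) ∈ relBoundaries m := by
    constructor
    · simpa [hl, hr, hf] using boundary_mem_relBoundaries h
    · have h' : z ∈ m.toSubmodule ∨ f x ∈ m.toSubmodule ∨ f y ∈ m.toSubmodule := by tauto
      simpa [hl, hr, hf] using boundary_mem_relBoundaries h'
  suffices H : k.commSpan ≤ (relBoundaries m).comap ((pure₂ F).flip z ∘ₗ f) ⊓
      (relBoundaries m).comap (pure₂ F z ∘ₗ f) from H hc
  refine Submodule.span_le.2 ?_
  rintro _ ⟨x, a, ha, rfl | rfl⟩
  · exact key x a (Or.inr (hk a ha))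
  · exact key a x ((hk a ha).imp_right Or.inr)

end CommutingElement

section MixedLift

variable {F : Type*} [Field F] {g₁ g₂ : Type*}
  [AddCommGroup g₁] [Module F g₁] [LeibnizAlgebra F g₁]
  [AddCommGroup g₂] [Module F g₂] [LeibnizAlgebra F g₂]
  (n₁ : LeibnizIdeal F g₁) (n₂ : LeibnizIdeal F g₂)

theorem br_inl_inl (x y : g₁) : ((br F x y, 0) : g₁ × g₂) = br F (x, 0) (y, 0) :=
  Prod.ext rfl (by simp [br, LeibnizAlgebra.br])

theorem br_inr_inr (x y : g₂) : ((0, br F x y) : g₁ × g₂) = br F (0, x) (0, y) :=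
  Prod.ext (by simp [br, LeibnizAlgebra.br]) rfl

theorem br_inl_inr (x : g₁) (y : g₂) : br F ((x, 0) : g₁ × g₂) (0, y) = 0 :=
  Prod.ext (by simp [br, LeibnizAlgebra.br]) (by simp [br, LeibnizAlgebra.br])

theorem br_inr_inl (y : g₂) (x : g₁) : br F ((0, y) : g₁ × g₂) (x, 0) = 0 :=
  Prod.ext (by simp [br, LeibnizAlgebra.br]) (by simp [br, LeibnizAlgebra.br])

theorem mixed_mem_relBoundaries_left (k : LeibnizIdeal F g₁) {b : g₂}
    (hk : ∀ a ∈ k.toSubmodule, a ∈ n₁.toSubmodule ∨ b ∈ n₂.toSubmodule) {c : g₁}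
    (hc : c ∈ k.commSpan) :
    pure₂ F ((c, 0) : g₁ × g₂) (0, b) ∈ relBoundaries (n₁.prod n₂) ∧
      pure₂ F ((0, b) : g₁ × g₂) (c, 0) ∈ relBoundaries (n₁.prod n₂) :=
  pure₂_mem_relBoundaries_of_mem_commSpan (m := n₁.prod n₂) (f := LinearMap.inl F g₁ g₂) br_inl_inl k
    (br_inr_inl b) (fun x => br_inl_inr x b)
    (fun a ha => (hk a ha).imp (fun h => ⟨h, n₂.zero_mem⟩) (fun h => ⟨n₁.zero_mem, h⟩)) hc

theorem mixed_mem_relBoundaries_right (k : LeibnizIdeal F g₂) {a : g₁}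
    (hk : ∀ b ∈ k.toSubmodule, b ∈ n₂.toSubmodule ∨ a ∈ n₁.toSubmodule) {c : g₂}
    (hc : c ∈ k.commSpan) :
    pure₂ F ((0, c) : g₁ × g₂) (a, 0) ∈ relBoundaries (n₁.prod n₂) ∧
      pure₂ F ((a, 0) : g₁ × g₂) (0, c) ∈ relBoundaries (n₁.prod n₂) :=
  pure₂_mem_relBoundaries_of_mem_commSpan (m := n₁.prod n₂) (f := LinearMap.inr F g₁ g₂) br_inr_inr k
    (br_inl_inr a) (fun x => br_inr_inl x a)
    (fun b hb => (hk b hb).imp (fun h => ⟨n₁.zero_mem, h⟩) (fun h => ⟨h, n₂.zero_mem⟩)) hc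

/-- The pairing `(a, b) ↦ a ⊗ b` of `g₁` and `g₂` modulo relative boundaries. -/
def mixedPairing : g₁ →ₗ[F] g₂ →ₗ[F] (CL F (g₁ × g₂) 2 ⧸ relBoundaries (n₁.prod n₂)) :=
  ((pure₂ F).compl₁₂ (LinearMap.inl F g₁ g₂) (LinearMap.inr F g₁ g₂)).compr₂
    (relBoundaries (n₁.prod n₂)).mkQ

/-- The pairing `(b, a) ↦ b ⊗ a` of `g₂` and `g₁` modulo relative boundaries. -/
def mixedPairing' : g₂ →ₗ[F] g₁ →ₗ[F] (CL F (g₁ × g₂) 2 ⧸ relBoundaries (n₁.prod n₂)) :=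
  ((pure₂ F).compl₁₂ (LinearMap.inr F g₁ g₂) (LinearMap.inl F g₁ g₂)).compr₂
    (relBoundaries (n₁.prod n₂)).mkQ

theorem mixedPairing_eq_zero {a : g₁} {b : g₂} : mixedPairing n₁ n₂ a b = 0 ↔
    pure₂ F ((a, 0) : g₁ × g₂) (0, b) ∈ relBoundaries (n₁.prod n₂) :=
  Submodule.Quotient.mk_eq_zero _

theorem mixedPairing'_eq_zero {b : g₂} {a : g₁} : mixedPairing' n₁ n₂ b a = 0 ↔
    pure₂ F ((0, b) : g₁ × g₂) (a, 0) ∈ relBoundaries (n₁.prod n₂) :=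
  Submodule.Quotient.mk_eq_zero _

/-- The map `n̄₁ ∗ ḡ₂ → CL₂(g₁ ⊕ g₂) / (relative boundaries)`. -/
def mixedLiftLeft : TrivTensor F n₁.Bar (Ab F g₂) →ₗ[F]
    (CL F (g₁ × g₂) 2 ⧸ relBoundaries (n₁.prod n₂)) :=
  TrivTensor.lift (LeibnizIdeal.Bar.br_eq_zero n₁) Ab.br_eq_zero
    (liftQ₂ _ _ (mixedPairing n₁ n₂ ∘ₗ n₁.toSubmodule.subtype)
      (fun _ ha _ => (mixedPairing_eq_zero n₁ n₂).2
        (mixed_mem_relBoundaries_left n₁ n₂ n₁ (fun _ h => Or.inl h) ha).1)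
      (fun a _ hb => (mixedPairing_eq_zero n₁ n₂).2
        (mixed_mem_relBoundaries_right n₁ n₂ (.whole F g₂) (fun _ _ => Or.inr a.2) hb).2))
    (liftQ₂ _ _ ((mixedPairing' n₁ n₂).compl₂ n₁.toSubmodule.subtype)
      (fun _ hb a => (mixedPairing'_eq_zero n₁ n₂).2
        (mixed_mem_relBoundaries_right n₁ n₂ (.whole F g₂) (fun _ _ => Or.inr a.2) hb).1)
      (fun _ _ ha => (mixedPairing'_eq_zero n₁ n₂).2
        (mixed_mem_relBoundaries_left n₁ n₂ n₁ (fun _ h => Or.inl h) ha).2))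

/-- The map `ḡ₁ ∗ n̄₂ → CL₂(g₁ ⊕ g₂) / (relative boundaries)`. -/
def mixedLiftRight : TrivTensor F (Ab F g₁) n₂.Bar →ₗ[F]
    (CL F (g₁ × g₂) 2 ⧸ relBoundaries (n₁.prod n₂)) :=
  TrivTensor.lift Ab.br_eq_zero (LeibnizIdeal.Bar.br_eq_zero n₂)
    (liftQ₂ _ _ ((mixedPairing n₁ n₂).compl₂ n₂.toSubmodule.subtype)
      (fun _ ha b => (mixedPairing_eq_zero n₁ n₂).2
        (mixed_mem_relBoundaries_left n₁ n₂ (.whole F g₁) (fun _ _ => Or.inr b.2) ha).1)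
      (fun _ _ hb => (mixedPairing_eq_zero n₁ n₂).2
        (mixed_mem_relBoundaries_right n₁ n₂ n₂ (fun _ h => Or.inl h) hb).2))
    (liftQ₂ _ _ (mixedPairing' n₁ n₂ ∘ₗ n₂.toSubmodule.subtype)
      (fun _ hb _ => (mixedPairing'_eq_zero n₁ n₂).2
        (mixed_mem_relBoundaries_right n₁ n₂ n₂ (fun _ h => Or.inl h) hb).1)
      (fun b _ ha => (mixedPairing'_eq_zero n₁ n₂).2
        (mixed_mem_relBoundaries_left n₁ n₂ (.whole F g₁) (fun _ _ => Or.inr b.2) ha).2))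

theorem mixedLiftLeft_tmulL (a : n₁.toSubmodule) (b : g₂) :
    mixedLiftLeft n₁ n₂ (tmulL F (n₁.toBar a) (toAb F b)) = mixedPairing n₁ n₂ a b :=
  TrivTensor.lift_tmulL _ _ _ _ _ _

theorem mixedLiftLeft_tmulR (b : g₂) (a : n₁.toSubmodule) :
    mixedLiftLeft n₁ n₂ (tmulR F (toAb F b) (n₁.toBar a)) = mixedPairing' n₁ n₂ b a :=
  TrivTensor.lift_tmulR _ _ _ _ _ _

theorem mixedLiftRight_tmulL (a : g₁) (b : n₂.toSubmodule) :
    mixedLiftRight n₁ n₂ (tmulL F (toAb F a) (n₂.toBar b)) = mixedPairing n₁ n₂ a b :=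
  TrivTensor.lift_tmulL _ _ _ _ _ _

theorem mixedLiftRight_tmulR (b : n₂.toSubmodule) (a : g₁) :
    mixedLiftRight n₁ n₂ (tmulR F (n₂.toBar b) (toAb F a)) = mixedPairing' n₁ n₂ b a :=
  TrivTensor.lift_tmulR _ _ _ _ _ _

theorem mixedIdeal_le_ker :
    (mixedIdeal n₁ n₂).toSubmodule ≤
      LinearMap.ker ((mixedLiftLeft n₁ n₂).coprod (mixedLiftRight n₁ n₂)) := by
  refine sInf_le ⟨?_, fun x _ y _ => ?_⟩
  · rintro _ ⟨a, b, rfl | rfl⟩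
    · rw [SetLike.mem_coe, LinearMap.mem_ker, LinearMap.coprod_apply, map_neg,
        mixedLiftLeft_tmulL, mixedLiftRight_tmulL, add_neg_cancel]
    · rw [SetLike.mem_coe, LinearMap.mem_ker, LinearMap.coprod_apply, map_neg,
        mixedLiftLeft_tmulR, mixedLiftRight_tmulR, add_neg_cancel]
  · rw [MixedSum.br_eq_zero]
    exact Submodule.zero_mem _

/-- The map from the mixed term to `CL₂(g₁ ⊕ g₂) / (relative boundaries)` that sends the class of
`ā ∗ b̄` to the class of `a ⊗ b`. -/
def mixedLift : MixedTerm n₁ n₂ →ₗ[F] (CL F (g₁ × g₂) 2 ⧸ relBoundaries (n₁.prod n₂)) :=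
  (mixedIdeal n₁ n₂).toSubmodule.liftQ _ (mixedIdeal_le_ker n₁ n₂)

theorem mixedLift_mixedInl (u : TrivTensor F n₁.Bar (Ab F g₂)) :
    mixedLift n₁ n₂ (mixedInl n₁ n₂ u) = mixedLiftLeft n₁ n₂ u := by
  have : mixedLift n₁ n₂ (mixedInl n₁ n₂ u) =
      (mixedLiftLeft n₁ n₂).coprod (mixedLiftRight n₁ n₂) (u, 0) := rfl
  rw [this, LinearMap.coprod_apply, map_zero, add_zero]

theorem mixedLift_mixedInr (u : TrivTensor F (Ab F g₁) n₂.Bar) :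
    mixedLift n₁ n₂ (mixedInr n₁ n₂ u) = mixedLiftRight n₁ n₂ u := by
  have : mixedLift n₁ n₂ (mixedInr n₁ n₂ u) =
      (mixedLiftLeft n₁ n₂).coprod (mixedLiftRight n₁ n₂) (0, u) := rfl
  rw [this, LinearMap.coprod_apply, map_zero, zero_add]

/-- On relative chains, `mixedLift` inverts `mixedPart` up to the two unmixed parts. -/
theorem mixedLift_mixedPart {t : CL F (g₁ × g₂) 2} (ht : t ∈ relChains (n₁.prod n₂) 2) :
    mixedLift n₁ n₂ (mixedPart n₁ n₂ t) = (relBoundaries (n₁.prod n₂)).mkQ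
      (t - CLmap (projLeft F g₁ g₂) 2 t - CLmap (projRight F g₁ g₂) 2 t) := by
  suffices H : relChains (n₁.prod n₂) 2 ≤
      LinearMap.eqLocus (mixedLift n₁ n₂ ∘ₗ mixedPart n₁ n₂) ((relBoundaries (n₁.prod n₂)).mkQ ∘ₗ
        (LinearMap.id - CLmap (projLeft F g₁ g₂) 2 - CLmap (projRight F g₁ g₂) 2)) from H ht
  refine relChains_two_le fun u v huv => ?_
  have e : (LinearMap.id - CLmap (projLeft F g₁ g₂) 2 - CLmap (projRight F g₁ g₂) 2 :
      CL F (g₁ × g₂) 2 →ₗ[F] CL F (g₁ × g₂) 2) (pure₂ F u v) =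
      pure₂ F (u.1, 0) (0, v.2) + pure₂ F (0, u.2) (v.1, 0) := by
    rw [LinearMap.sub_apply, LinearMap.sub_apply, LinearMap.id_apply, sub_eq_iff_eq_add,
      sub_eq_iff_eq_add, add_right_comm, ← pure₂_eq_sum]
  rw [LinearMap.mem_eqLocus, LinearMap.comp_apply, LinearMap.comp_apply, e]
  rcases huv with ⟨h₁, h₂⟩ | ⟨h₁, h₂⟩
  · rw [mixedPart_of_mem_left n₁ n₂ v h₁ h₂, map_add, mixedLift_mixedInl, mixedLift_mixedInr,
      tmulLHom_apply, tmulRHom_apply, mixedLiftLeft_tmulL, mixedLiftRight_tmulR]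
    rfl
  · rw [mixedPart_of_mem_right n₁ n₂ u h₁ h₂, map_add, mixedLift_mixedInl, mixedLift_mixedInr,
      tmulLHom_apply, tmulRHom_apply, mixedLiftLeft_tmulR, mixedLiftRight_tmulL, add_comm]
    rfl

/-- The mixed term is realized by cycles without unmixed parts. -/
theorem exists_mixed_cycle (u : MixedTerm n₁ n₂) : ∃ t ∈ relCycles (n₁.prod n₂),
    CLmap (LinearMap.fst F g₁ g₂) 2 t = 0 ∧ CLmap (LinearMap.snd F g₁ g₂) 2 t = 0 ∧
      mixedPart n₁ n₂ t = u := by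
  have hL (a : g₁) (b : g₂) (h : a ∈ n₁.toSubmodule ∨ b ∈ n₂.toSubmodule) :
      pure₂ F ((a, 0) : g₁ × g₂) (0, b) ∈ relCycles (n₁.prod n₂) ⊓
        (LinearMap.ker (CLmap (LinearMap.fst F g₁ g₂) 2) ⊓
          LinearMap.ker (CLmap (LinearMap.snd F g₁ g₂) 2)) := by
    refine ⟨⟨pure₂_mem_relChains (h.imp (fun h => ⟨h, n₂.zero_mem⟩)
      (fun h => ⟨n₁.zero_mem, h⟩)), ?_⟩, ?_, ?_⟩
    · simp [boundary_one, br_inl_inr]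
    · simp
    · simp
  have hR (b : g₂) (a : g₁) (h : a ∈ n₁.toSubmodule ∨ b ∈ n₂.toSubmodule) :
      pure₂ F ((0, b) : g₁ × g₂) (a, 0) ∈ relCycles (n₁.prod n₂) ⊓
        (LinearMap.ker (CLmap (LinearMap.fst F g₁ g₂) 2) ⊓
          LinearMap.ker (CLmap (LinearMap.snd F g₁ g₂) 2)) := by
    refine ⟨⟨pure₂_mem_relChains (h.symm.imp (fun h => ⟨n₁.zero_mem, h⟩)
      (fun h => ⟨h, n₂.zero_mem⟩)), ?_⟩, ?_, ?_⟩
    · simp [boundary_one, br_inr_inl]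
    · simp
    · simp
  have H : u ∈ (relCycles (n₁.prod n₂) ⊓
      (LinearMap.ker (CLmap (LinearMap.fst F g₁ g₂) 2) ⊓
        LinearMap.ker (CLmap (LinearMap.snd F g₁ g₂) 2))).map (mixedPart n₁ n₂) := by
    refine MixedTerm.mem_of_generators n₁ n₂ (fun a b => ?_) (fun b a => ?_) (fun a b => ?_)
      (fun b a => ?_) u
    · refine ⟨_, hL a b (Or.inl a.2), ?_⟩
      rw [mixedPart_of_mem_left n₁ n₂ (u := ((a : g₁), (0 : g₂))) _ a.2 n₂.zero_mem]
      simp [tmulLHom_apply]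
    · refine ⟨_, hR b a (Or.inl a.2), ?_⟩
      rw [mixedPart_of_mem_right n₁ n₂ (v := ((a : g₁), (0 : g₂))) _ a.2 n₂.zero_mem]
      simp [tmulRHom_apply]
    · refine ⟨_, hL a b (Or.inr b.2), ?_⟩
      rw [mixedPart_of_mem_right n₁ n₂ (v := ((0 : g₁), (b : g₂))) _ n₁.zero_mem b.2]
      simp [tmulLHom_apply]
    · refine ⟨_, hR b a (Or.inr b.2), ?_⟩
      rw [mixedPart_of_mem_left n₁ n₂ (u := ((0 : g₁), (b : g₂))) _ n₁.zero_mem b.2]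
      simp [tmulRHom_apply]
  obtain ⟨t, ⟨h₀, h₁, h₂⟩, rfl⟩ := H
  exact ⟨t, h₀, h₁, h₂, rfl⟩

end MixedLift

/-! ### The decomposition of relative cycles -/

section Decomposition

variable {F : Type*} [Field F] {g₁ g₂ : Type*}
  [AddCommGroup g₁] [Module F g₁] [LeibnizAlgebra F g₁]
  [AddCommGroup g₂] [Module F g₂] [LeibnizAlgebra F g₂]
  (n₁ : LeibnizIdeal F g₁) (n₂ : LeibnizIdeal F g₂)

/-- The map that sends a relative cycle of `g₁ ⊕ g₂` to the classes of its two unmixed parts and of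
its mixed part. -/
def decompose : relCycles (n₁.prod n₂) →ₗ[F]
    (relCycles n₁ ⧸ (relBoundaries n₁).comap (relCycles n₁).subtype) ×
      (relCycles n₂ ⧸ (relBoundaries n₂).comap (relCycles n₂).subtype) × MixedTerm n₁ n₂ :=
  (Submodule.mkQ _ ∘ₗ (CLmap (LinearMap.fst F g₁ g₂) 2).restrict
      (fun _ => CLmap_mem_relCycles (n := n₁.prod n₂) (m := n₁) (fun _ _ => rfl)
        (fun _ h => h.1))).prod
    ((Submodule.mkQ _ ∘ₗ (CLmap (LinearMap.snd F g₁ g₂) 2).restrict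
      (fun _ => CLmap_mem_relCycles (n := n₁.prod n₂) (m := n₂) (fun _ _ => rfl)
        (fun _ h => h.2))).prod
    (mixedPart n₁ n₂ ∘ₗ (relCycles (n₁.prod n₂)).subtype))

theorem decompose_eq_zero {t : relCycles (n₁.prod n₂)} : decompose n₁ n₂ t = 0 ↔
    CLmap (LinearMap.fst F g₁ g₂) 2 t ∈ relBoundaries n₁ ∧
      CLmap (LinearMap.snd F g₁ g₂) 2 t ∈ relBoundaries n₂ ∧ mixedPart n₁ n₂ t = 0 := by
  refine Prod.ext_iff.trans (and_congr ?_ (Prod.ext_iff.trans (and_congr ?_ Iff.rfl)))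
  · exact Submodule.Quotient.mk_eq_zero _
  · exact Submodule.Quotient.mk_eq_zero _

theorem ker_decompose : LinearMap.ker (decompose n₁ n₂) =
    (relBoundaries (n₁.prod n₂)).comap (relCycles (n₁.prod n₂)).subtype := by
  ext ⟨t, ht⟩
  rw [LinearMap.mem_ker, decompose_eq_zero, Submodule.mem_comap, Submodule.subtype_apply]
  constructor
  · rintro ⟨h₁, h₂, h₃⟩
    have h := mixedLift_mixedPart n₁ n₂ ht.1
    rw [h₃, map_zero, eq_comm, Submodule.mkQ_apply, Submodule.Quotient.mk_eq_zero] at h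
    have e₁ := CLmap_mem_relBoundaries (f := LinearMap.inl F g₁ g₂) (m := n₁.prod n₂) br_inl_inl
      (fun _ h => ⟨h, n₂.zero_mem⟩) h₁
    have e₂ := CLmap_mem_relBoundaries (f := LinearMap.inr F g₁ g₂) (m := n₁.prod n₂) br_inr_inr
      (fun _ h => ⟨n₁.zero_mem, h⟩) h₂
    rw [CLmap_comp_apply] at e₁ e₂
    have := add_mem (add_mem h e₂) e₁
    change t - CLmap (projLeft F g₁ g₂) 2 t - CLmap (projRight F g₁ g₂) 2 t +
      CLmap (projRight F g₁ g₂) 2 t + CLmap (projLeft F g₁ g₂) 2 t ∈ _ at this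
    rwa [sub_add_cancel, sub_add_cancel] at this
  · intro h
    exact ⟨CLmap_mem_relBoundaries (n := n₁.prod n₂) (m := n₁) (fun _ _ => rfl)
        (fun _ h => h.1) h,
      CLmap_mem_relBoundaries (n := n₁.prod n₂) (m := n₂) (fun _ _ => rfl)
        (fun _ h => h.2) h,
      mixedPart_of_mem_relBoundaries n₁ n₂ h⟩

theorem mixedPart_inl (t : CL F g₁ 2) :
    mixedPart n₁ n₂ (CLmap (LinearMap.inl F g₁ g₂) 2 t) = 0 := by
  suffices H : mixedPart n₁ n₂ ∘ₗ CLmap (LinearMap.inl F g₁ g₂) 2 = 0 from LinearMap.congr_fun H t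
  exact CL₂_ext fun x y => by simp [mixedPart_pure₂]

theorem mixedPart_inr (t : CL F g₂ 2) :
    mixedPart n₁ n₂ (CLmap (LinearMap.inr F g₁ g₂) 2 t) = 0 := by
  suffices H : mixedPart n₁ n₂ ∘ₗ CLmap (LinearMap.inr F g₁ g₂) 2 = 0 from LinearMap.congr_fun H t
  exact CL₂_ext fun x y => by simp [mixedPart_pure₂]

theorem decompose_surjective : Function.Surjective (decompose n₁ n₂) := by
  rintro ⟨z₁, z₂, u⟩
  obtain ⟨⟨t₁, h₁⟩, rfl⟩ := Submodule.mkQ_surjective _ z₁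
  obtain ⟨⟨t₂, h₂⟩, rfl⟩ := Submodule.mkQ_surjective _ z₂
  obtain ⟨t, ht, e₁, e₂, rfl⟩ := exists_mixed_cycle n₁ n₂ u
  have m₁ := CLmap_mem_relCycles (f := LinearMap.inl F g₁ g₂) (m := n₁.prod n₂) br_inl_inl
    (fun _ h => ⟨h, n₂.zero_mem⟩) h₁
  have m₂ := CLmap_mem_relCycles (f := LinearMap.inr F g₁ g₂) (m := n₁.prod n₂) br_inr_inr
    (fun _ h => ⟨n₁.zero_mem, h⟩) h₂
  refine ⟨⟨_, add_mem (add_mem m₁ m₂) ht⟩, Prod.ext ?_ (Prod.ext ?_ ?_)⟩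
  · refine congrArg (Submodule.mkQ _) (Subtype.ext ?_)
    change CLmap (LinearMap.fst F g₁ g₂) 2 (CLmap (LinearMap.inl F g₁ g₂) 2 t₁ +
      CLmap (LinearMap.inr F g₁ g₂) 2 t₂ + t) = t₁
    rw [map_add, map_add, e₁, CLmap_comp_apply, CLmap_comp_apply, LinearMap.fst_comp_inl,
      LinearMap.fst_comp_inr, CLmap_id_apply, CLmap_zero_two, LinearMap.zero_apply, add_zero,
      add_zero]
  · refine congrArg (Submodule.mkQ _) (Subtype.ext ?_)
    change CLmap (LinearMap.snd F g₁ g₂) 2 (CLmap (LinearMap.inl F g₁ g₂) 2 t₁ +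
      CLmap (LinearMap.inr F g₁ g₂) 2 t₂ + t) = t₂
    rw [map_add, map_add, e₂, CLmap_comp_apply, CLmap_comp_apply, LinearMap.snd_comp_inl,
      LinearMap.snd_comp_inr, CLmap_id_apply, CLmap_zero_two, LinearMap.zero_apply, add_zero,
      zero_add]
  · change mixedPart n₁ n₂ (CLmap (LinearMap.inl F g₁ g₂) 2 t₁ +
      CLmap (LinearMap.inr F g₁ g₂) 2 t₂ + t) = mixedPart n₁ n₂ t
    rw [map_add, map_add, mixedPart_inl, mixedPart_inr, zero_add, zero_add]

/-- The linear isomorphism underlying the decomposition of `HL₂(g₁ ⊕ g₂, n₁ ⊕ n₂)`. -/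
def HL₂ProdEquiv : HL₂ (n₁.prod n₂) ≃ₗ[F] HL₂ n₁ × HL₂ n₂ × MixedTerm n₁ n₂ :=
  (HL₂Equiv (n₁.prod n₂)).symm.trans
    ((Submodule.quotEquivOfEq _ _ (ker_decompose n₁ n₂).symm).trans
      (((decompose n₁ n₂).quotKerEquivOfSurjective (decompose_surjective n₁ n₂)).trans
        ((HL₂Equiv n₁).prodCongr ((HL₂Equiv n₂).prodCongr (LinearEquiv.refl F _)))))

end Decomposition

end RelLeibniz

end

theorem corollary3p3 {F : Type*} [Field F] {g₁ g₂ : Type*}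
    [AddCommGroup g₁] [Module F g₁] [RelLeibniz.LeibnizAlgebra F g₁]
    [AddCommGroup g₂] [Module F g₂] [RelLeibniz.LeibnizAlgebra F g₂]
    (n₁ : RelLeibniz.LeibnizIdeal F g₁) (n₂ : RelLeibniz.LeibnizIdeal F g₂) :
    Nonempty (RelLeibniz.LeibnizEquiv F
      (RelLeibniz.HL₂ (n₁.prod n₂))
      (RelLeibniz.HL₂ n₁ × RelLeibniz.HL₂ n₂ × RelLeibniz.MixedTerm n₁ n₂)) := by
  refine ⟨{ RelLeibniz.HL₂ProdEquiv n₁ n₂ with map_br := fun x y => ?_ }⟩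
  refine (map_zero (RelLeibniz.HL₂ProdEquiv n₁ n₂)).trans (Prod.ext rfl (Prod.ext rfl ?_))
  exact (RelLeibniz.MixedTerm.br_eq_zero n₁ n₂ _ _).symm
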